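/- **Setting.** Let $0\le\gamma<1$ and let $\beta:(0,\pi/2)\to\mathbb{R}$ be measurable, not almost everywhere zero, with $0\le\beta(\theta)\le C\cos\theta\sin\theta$ for some constant $C$; the pair $(\gamma,\beta)$ is called the potential, and the cross section is $B(|V|,\theta)=|V|^{\gamma}\beta(\theta)$. The collision operator is $$Q(F,F)(\zeta)=\int_{\mathbb{R}^3}\int_0^{2\pi}\int_0^{\pi/2}(F'F'_*-FF_*)\,B(|\zeta_*-\zeta|,\theta)\,d\theta\,d\epsilon\,d\zeta_*,$$ with $\zeta'=\zeta+((\zeta_*-\zeta)\cdot\omega)\omega$, $\zeta_*'=\zeta_*-((\zeta_*-\zeta)\cdot\omega)\omega$, where $\omega$ is the unit vector with polar angle $\theta$ and azimuth $\epsilon$ about the axis $\zeta_*-\zeta$. Let $M(\zeta)=\pi^{-3/2}e^{-|\zeta|^2}$. The linearized operator $L$, for which $\sqrt M\,L(f)$ is the part of $Q(M+\sqrt M f,M+\sqrt M f)$ linear in $f$, splits as $L(f)=-\nu f+K(f)$, with collision frequency $$\nu(|\zeta|)=\int_{\mathbb{R}^3}\int_0^{2\pi}\int_0^{\pi/2}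 M_*B\,d\theta\,d\epsilon\,d\zeta_*=\frac{2}{\sqrt\pi}\int_0^{\pi/2}\beta(\theta)\,d\theta\int_{\mathbb{R}^3}e^{-|\eta|^2}|\eta-\zeta|^\gamma\,d\eta$$ and integral part $$K(f)(\zeta)=M(\zeta)^{-1/2}\int_{\mathbb{R}^3}\int_0^{2\pi}\int_0^{\pi/2}\big(M'(\sqrt M f)'_*+(\sqrt M f)'M'_*-M(\sqrt M f)_*\big)B\,d\theta\,d\epsilon\,d\zeta_*.$$ Put $\|g\|_{L^*_\zeta}=\big(\int_{\mathbb{R}^3}|g(\zeta)|^2\nu(|\zeta|)\,d\zeta\big)^{1/2}$. For a bounded open convex set $\Omega\subset\mathbb{R}^3$ with diameter $R$ (for instance a bounded convex $C^1$ domain), $x\in\Omega$ and $\zeta\neq0$, let $\tau_-(x,\zeta)>0$ be the time at which the backward trajectory $x-t\zeta$ reaches $\partial\Omega$. For a measurable $f:\Omega\times\mathbb{R}^3\to\mathbb{R}$ with $\int_\Omega\|f(x,\cdot)\|_{L^*_\zeta}^2\,dx<\infty$ (for instance a stationary solution in this space of the linearized Boltzmann equation $\zeta\cdot\nabla f=L(f)$)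 put $$\tilde f(x,\zeta)=\int_0^{\tau_-(x,\zeta)}e^{-\nu(|\zeta|)s}K(f)(x-\zeta s,\zeta)\,ds,$$ where $K(f)(y,\cdot)=K(f(y,\cdot))$. **Lemma.** Let $0<\alpha<1$. There is a constant $C_{11}>0$, depending only on the potential and on $\alpha$, such that for all $\Omega$ and $f$ as above the integral defining $K(f)(y,\zeta)$ converges absolutely for almost every $y\in\Omega$ and all $\zeta$, and, for every $x\in\Omega$, $$\|\tilde f(x,\cdot)\|_{L^*_\zeta}^2\le C_{11}\left(\frac{\chi_{(0,R)}(|\cdot|)}{|\cdot|^{2-\alpha}}*\|f(\cdot,\cdot)\|_{L^*_\zeta}^2\right)(x) =C_{11}\int_{\Omega}\frac{\chi_{(0,R)}(|x-y|)}{|x-y|^{2-\alpha}}\,\|f(y,\cdot)\|_{L^*_\zeta}^2\,dy .$$ Here $*$ is convolution in space, $f$ is extended by zero outside $\Omega$, and the right-hand side may be $+\infty$; if it is finite at $x$, then the integral defining $\tilde f(x,\zeta)$ converges absolutely for almost every $\zeta$. -/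

import Mathlib

open Real Set MeasureTheory
open scoped ENNReal

noncomputable section

namespace LinBoltz

/-- The space `ℝ³`, used for positions and for velocities. -/
abbrev E3 : Type := EuclideanSpace ℝ (Fin 3)

/-! ### Collisions -/

/-- The pair `(γ, β)` is the potential: the cross section is `B(r, θ) = r ^ γ * β θ`, with
`0 ≤ γ < 1` (cutoff Maxwellian and cutoff hard potentials), `0 ≤ β θ ≤ C cos θ sin θ` on
`(0, π / 2)`, and `β` nontrivial. -/
structure IsCutoffPotential (γ : ℝ) (β : ℝ → ℝ) : Prop where
  nonneg_gamma : 0 ≤ γ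
  gamma_lt_one : γ < 1
  measurable_beta : Measurable β
  bound_beta : ∃ C : ℝ, ∀ θ ∈ Ioo (0 : ℝ) (π / 2), 0 ≤ β θ ∧ β θ ≤ C * (cos θ * sin θ)
  nontrivial_beta : ¬ (∀ᵐ θ ∂(volume.restrict (Ioo (0 : ℝ) (π / 2))), β θ = 0)

/-- The cross section `B(|V|, θ) = |V| ^ γ * β(θ)` (it contains the factor `sin θ` of the surface
element of the sphere). -/
def crossSection (γ : ℝ) (β : ℝ → ℝ) (r θ : ℝ) : ℝ := r ^ γ * β θ

/-- The first coordinate vector. -/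
def axis : E3 := EuclideanSpace.single 0 1

/-- The unit vector with polar angle `θ` and azimuth `ε` relative to the axis `V / |V|`.
The reflection maps `axis` to `V / |V|`, so it carries the spherical coordinates around `axis` to
spherical coordinates around `V / |V|`. -/
def apse (V : E3) (θ ε : ℝ) : E3 :=
  (ℝ ∙ (axis - ‖V‖⁻¹ • V))ᗮ.reflection !₂[cos θ, sin θ * cos ε, sin θ * sin ε]

theorem norm_apse (V : E3) (θ ε : ℝ) : ‖apse V θ ε‖ = 1 := by
  unfold apse
  rw [LinearIsometryEquiv.norm_map, EuclideanSpace.norm_eq]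
  simp [Fin.sum_univ_three, mul_pow]
  nlinarith [sin_sq_add_cos_sq θ, sin_sq_add_cos_sq ε]

/-- `θ` is the angle between `V` and `apse V θ ε`. -/
theorem inner_apse (V : E3) (θ ε : ℝ) : inner ℝ V (apse V θ ε) = ‖V‖ * cos θ := by
  rcases eq_or_ne V 0 with rfl | hV
  · simp
  have hn : ‖V‖ ≠ 0 := norm_ne_zero_iff.2 hV
  have h1 : (ℝ ∙ (axis - ‖V‖⁻¹ • V))ᗮ.reflection axis = ‖V‖⁻¹ • V := by
    apply Submodule.reflection_sub
    simp [axis, norm_smul, hn]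
  have h2 : V = ‖V‖ • (ℝ ∙ (axis - ‖V‖⁻¹ • V))ᗮ.reflection axis := by
    rw [h1, smul_smul, mul_inv_cancel₀ hn, one_smul]
  unfold apse
  conv_lhs => enter [2]; rw [h2]
  rw [inner_smul_left, LinearIsometryEquiv.inner_map_map]
  simp [axis, EuclideanSpace.inner_single_left]

/-- Velocity `ζ'` after the collision of `ζ` and `ζ_*`. -/
def postVel (ζ ζs : E3) (θ ε : ℝ) : E3 :=
  ζ + (inner ℝ (ζs - ζ) (apse (ζs - ζ) θ ε)) • apse (ζs - ζ) θ ε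

/-- Velocity `ζ_*'` after the collision of `ζ` and `ζ_*`. -/
def postVelStar (ζ ζs : E3) (θ ε : ℝ) : E3 :=
  ζs - (inner ℝ (ζs - ζ) (apse (ζs - ζ) θ ε)) • apse (ζs - ζ) θ ε

/-- The measure `dθ dε dζ_*`, for `(ζ_*, ε, θ) ∈ ℝ³ × (0, 2π) × (0, π / 2)`. -/
def collisionMeasure : Measure (E3 × ℝ × ℝ) :=
  volume.restrict (univ ×ˢ (Ioo (0 : ℝ) (2 * π) ×ˢ Ioo (0 : ℝ) (π / 2)))

/-- The standard Maxwellian `π^{-3/2} exp(-|ζ|²)`. -/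
def maxwellian (ζ : E3) : ℝ := π ^ (-(3 / 2) : ℝ) * exp (-‖ζ‖ ^ 2)

/-- The binary collision operator `Q(F, F)`. -/
def collisionOp (γ : ℝ) (β : ℝ → ℝ) (F : E3 → ℝ) (ζ : E3) : ℝ :=
  ∫ p, (F (postVel ζ p.1 p.2.2 p.2.1) * F (postVelStar ζ p.1 p.2.2 p.2.1) - F ζ * F p.1)
    * crossSection γ β ‖p.1 - ζ‖ p.2.2 ∂collisionMeasure

/-- `√M f`, the perturbation of the Maxwellian `M` that corresponds to `f`. -/
def perturb (f : E3 → ℝ) (ζ : E3) : ℝ := √(maxwellian ζ) * f ζ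

/-- The linearized collision operator: `√M · L f` is the part of `Q(M + √M f, M + √M f)` that is
linear in `f`. -/
def linearizedOp (γ : ℝ) (β : ℝ → ℝ) (f : E3 → ℝ) (ζ : E3) : ℝ :=
  (√(maxwellian ζ))⁻¹ * ∫ p,
    (maxwellian (postVel ζ p.1 p.2.2 p.2.1) * perturb f (postVelStar ζ p.1 p.2.2 p.2.1)
      + perturb f (postVel ζ p.1 p.2.2 p.2.1) * maxwellian (postVelStar ζ p.1 p.2.2 p.2.1)
      - maxwellian ζ * perturb f p.1 - perturb f ζ * maxwellian p.1)
    * crossSection γ β ‖p.1 - ζ‖ p.2.2 ∂collisionMeasure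

/-- The collision frequency `ν`: `-ν f` is the part of `L f` that multiplies `f(ζ)`. -/
def collisionFreq (γ : ℝ) (β : ℝ → ℝ) (ζ : E3) : ℝ :=
  ∫ p, maxwellian p.1 * crossSection γ β ‖p.1 - ζ‖ p.2.2 ∂collisionMeasure

/-- The integrand of `√M · K f`: the integrand of `√M · L f` without the multiplicative part. -/
def nonlocalIntegrand (γ : ℝ) (β : ℝ → ℝ) (f : E3 → ℝ) (ζ : E3) (p : E3 × ℝ × ℝ) : ℝ :=
  (maxwellian (postVel ζ p.1 p.2.2 p.2.1) * perturb f (postVelStar ζ p.1 p.2.2 p.2.1)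
      + perturb f (postVel ζ p.1 p.2.2 p.2.1) * maxwellian (postVelStar ζ p.1 p.2.2 p.2.1)
      - maxwellian ζ * perturb f p.1)
    * crossSection γ β ‖p.1 - ζ‖ p.2.2

/-- The integral part `K` of the linearized collision operator, `L f = -ν f + K f`. -/
def integralOp (γ : ℝ) (β : ℝ → ℝ) (f : E3 → ℝ) (ζ : E3) : ℝ :=
  (√(maxwellian ζ))⁻¹ * ∫ p, nonlocalIntegrand γ β f ζ p ∂collisionMeasure

/-- The explicit form of the collision frequency. -/
theorem collisionFreq_eq (γ : ℝ) (β : ℝ → ℝ) (ζ : E3) :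
    collisionFreq γ β ζ = 2 * π ^ (-(1 / 2) : ℝ) * (∫ θ in Ioo (0 : ℝ) (π / 2), β θ) *
      ∫ η : E3, exp (-‖η‖ ^ 2) * ‖η - ζ‖ ^ γ := by
  have hm : collisionMeasure = (volume : Measure E3).prod
      ((volume.restrict (Ioo (0 : ℝ) (2 * π))).prod (volume.restrict (Ioo (0 : ℝ) (π / 2)))) := by
    unfold collisionMeasure
    rw [Measure.volume_eq_prod, ← Measure.prod_restrict, Measure.restrict_univ,
      Measure.volume_eq_prod, ← Measure.prod_restrict]
  unfold collisionFreq
  have : (fun p : E3 × ℝ × ℝ => maxwellian p.1 * crossSection γ β ‖p.1 - ζ‖ p.2.2) =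
      fun p => (π ^ (-(3 / 2) : ℝ) * (exp (-‖p.1‖ ^ 2) * ‖p.1 - ζ‖ ^ γ)) * ((1 : ℝ) * β p.2.2) := by
    ext p; unfold maxwellian crossSection; ring
  rw [this, hm, integral_prod_mul (fun η : E3 => π ^ (-(3 / 2) : ℝ) * (exp (-‖η‖ ^ 2) * ‖η - ζ‖ ^ γ))
    (fun q : ℝ × ℝ => (1 : ℝ) * β q.2), integral_prod_mul (fun _ : ℝ => (1 : ℝ)) β,
    integral_const_mul]
  have h3 : π ^ (-(1 / 2) : ℝ) = π ^ (-(3 / 2) : ℝ) * π := by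
    rw [← rpow_add_one pi_pos.ne']; norm_num
  rw [h3]
  simp [pi_pos.le]
  ring

/-- The decomposition `L f = -ν f + K f`. -/
theorem linearizedOp_eq (γ : ℝ) (β : ℝ → ℝ) (f : E3 → ℝ) (ζ : E3)
    (h1 : Integrable (nonlocalIntegrand γ β f ζ) collisionMeasure)
    (h2 : Integrable (fun p : E3 × ℝ × ℝ => maxwellian p.1 * crossSection γ β ‖p.1 - ζ‖ p.2.2)
      collisionMeasure) :
    linearizedOp γ β f ζ = -collisionFreq γ β ζ * f ζ + integralOp γ β f ζ := by
  have hM : √(maxwellian ζ) ≠ 0 := by unfold maxwellian; positivity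
  have : linearizedOp γ β f ζ = (√(maxwellian ζ))⁻¹ * ∫ p, (nonlocalIntegrand γ β f ζ p
      - perturb f ζ * (maxwellian p.1 * crossSection γ β ‖p.1 - ζ‖ p.2.2)) ∂collisionMeasure := by
    unfold linearizedOp nonlocalIntegrand
    congr 2; ext p; ring
  rw [this, integral_sub h1 (h2.const_mul _), integral_const_mul]
  unfold collisionFreq integralOp perturb
  field_simp
  ring

/-! ### Norms -/

/-- `‖g‖_{L^*_ζ} = (∫ |g|² ν dζ)^{1/2}`, possibly `∞`. -/
def normLStar (γ : ℝ) (β : ℝ → ℝ) (g : E3 → ℝ) : ℝ≥0∞ :=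
  (∫⁻ ζ, ENNReal.ofReal (|g ζ| ^ 2 * collisionFreq γ β ζ)) ^ (1 / 2 : ℝ)

/-- `f ∈ L^*_{x,ζ}`: `f` is measurable on `Ω × ℝ³` and `∫_Ω ∫ |f|² ν dζ dx < ∞`. -/
def MemLStar (γ : ℝ) (β : ℝ → ℝ) (Ω : Set E3) (f : E3 → E3 → ℝ) : Prop :=
  AEStronglyMeasurable (fun z : E3 × E3 => f z.1 z.2)
    ((volume.restrict Ω).prod (volume : Measure E3)) ∧
  (∫⁻ x in Ω, ∫⁻ ζ, ENNReal.ofReal (|f x ζ| ^ 2 * collisionFreq γ β ζ)) < ∞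

/-! ### The collision part of the mild formulation -/

/-- The time `τ_-(x, ζ)` at which the backward trajectory `x - t ζ` meets the boundary. -/
def exitTime (Ω : Set E3) (x ζ : E3) : ℝ := sInf {t : ℝ | 0 < t ∧ x - t • ζ ∈ frontier Ω}

/-- The integrand `e^{-ν(|ζ|) s} K(f)(x - ζ s, ζ)`. -/
def mildIntegrand (γ : ℝ) (β : ℝ → ℝ) (f : E3 → E3 → ℝ) (x ζ : E3) (s : ℝ) : ℝ :=
  exp (-collisionFreq γ β ζ * s) * integralOp γ β (f (x - s • ζ)) ζ

/-- `f̃(x, ζ) = ∫_0^{τ_-(x, ζ)} e^{-ν(|ζ|) s} K(f)(x - ζ s, ζ) ds`. -/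
def collisionPart (γ : ℝ) (β : ℝ → ℝ) (Ω : Set E3) (f : E3 → E3 → ℝ) (x ζ : E3) : ℝ :=
  ∫ s in (0 : ℝ)..exitTime Ω x ζ, mildIntegrand γ β f x ζ s

/-- The kernel `χ_{(0,R)}(|x|) / |x|^{2-α}`. -/
def rieszKernel (R α : ℝ) (x : E3) : ℝ≥0∞ :=
  ENNReal.ofReal ((Ioo 0 R).indicator (fun r : ℝ => 1 / r ^ (2 - α)) ‖x‖)

/-- Extension of `f` by zero outside `Ω` in the position variable. -/
def zeroExt (Ω : Set E3) (f : E3 → E3 → ℝ) : E3 → E3 → ℝ := Ω.indicator f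

/-- The convolution in space of the Riesz kernel with `x ↦ ‖f(x, ·)‖²_{L^*_ζ}`, where `f` is
extended by zero outside `Ω` and `R` is the diameter of `Ω`. -/
def rieszConv (γ : ℝ) (β : ℝ → ℝ) (α : ℝ) (Ω : Set E3) (f : E3 → E3 → ℝ) (x : E3) : ℝ≥0∞ :=
  lconvolution (rieszKernel (Metric.diam Ω) α)
    (fun y => normLStar γ β (zeroExt Ω f y) ^ 2) volume x

end LinBoltz

end

namespace LinBoltz

/-! Two facts carry the proof: K gains a full power of decay in velocity, and integration over time
and velocity along backward trajectories is, by scaling, a Riesz potential in space.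

Decay of K (`exists_enorm_integralOp_sq_le`): |K(g)(ζ)|² is at most a constant times (1+|ζ|)⁻² ‖g‖²,
the norm being that of L*. Energy conservation extracts √M(ζ) from each term, which cancels the
prefactor of K. The loss term is then elementary. The two gain terms are equivalent, since θ ↦ π/2 -
θ, ε ↦ ε + π exchanges ζ' and ζ_*'. In the remaining one put V = ζ_* - ζ and ζ' = ζ + pω with p =
V·ω, and integrate over V for fixed ω. The component of V orthogonal to ω does not enter ζ', and its
integral gives (1+|ζ|)^(γ-1) times a Gaussian in p and ζ·ω (`lintegral_gainWeight_le`). There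
remains an integral over rays from ζ. Cauchy–Schwarz (`sq_lintegral_ray_le`) bounds its square by ∫
|g|² (1+|v|)^γ dv, because p² dp dω is Lebesgue measure around ζ, times (1+|ζ|)^(-γ-1). One power of
the latter comes from the Gaussian in ζ·ω, which leaves only a thin band of directions. The
exponents add up to γ - 3 ≤ -2. Since ν is comparable to (1+|ζ|)^γ (`exists_collisionFreq_bounds`),
the norm is that of L*.

Trajectories: Cauchy–Schwarz in time with the weight s^α costs Γ(1-α) ν^(α-1)
(`sq_lintegral_exp_mul_le`). Together with the weight ν of the norm and the decay of K this leaves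
(1+|ζ|)^(γα-2) ∫ s^α N(x - sζ) ds, with N(y) = ‖f(y,·)‖². The substitutions y = sζ and s = |y|t turn
its integral over ζ into the convolution of N with |y|^(α-2), times a one-dimensional integral which
converges because γα < α (`lintegral_trajectory`, `lintegral_Ioi_scaling_lt_top`). The cutoff at R
costs nothing, since both x and x - y lie in Ω.

All estimates are made with values in [0, ∞], so finiteness and absolute convergence are
consequences. The function f is given only up to null sets. The same integral identities, applied to
the indicator of a null set, show that collisions and trajectories do not see such sets
(`ae_postVel_of_ae`, `ae_trajectory_of_ae`). -/

/-! ### Lebesgue integrals over `ℝ³` -/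

/-- The Cauchy–Schwarz inequality for lower Lebesgue integrals. -/
theorem sq_lintegral_mul_le {X : Type*} [MeasurableSpace X] {μ : Measure X} {f g : X → ℝ≥0∞}
    (hf : AEMeasurable f μ) (hg : AEMeasurable g μ) :
    (∫⁻ x, f x * g x ∂μ) ^ 2 ≤ (∫⁻ x, f x ^ 2 ∂μ) * ∫⁻ x, g x ^ 2 ∂μ := by
  have h := ENNReal.lintegral_mul_le_Lp_mul_Lq μ Real.HolderConjugate.two_two hf hg
  simp only [Pi.mul_apply, ENNReal.rpow_two] at h
  have key : ∀ a : ℝ≥0∞, (a ^ (1 / 2 : ℝ)) ^ 2 = a := fun a => by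
    rw [← ENNReal.rpow_two, ← ENNReal.rpow_mul]; norm_num
  calc _ ≤ ((∫⁻ x, f x ^ 2 ∂μ) ^ (1 / 2 : ℝ) * (∫⁻ x, g x ^ 2 ∂μ) ^ (1 / 2 : ℝ)) ^ 2 := by
        gcongr
    _ = _ := by rw [mul_pow, key, key]

/-- Cartesian coordinates on `E3`. -/
def cart (q : ℝ × ℝ × ℝ) : E3 := !₂[q.1, q.2.1, q.2.2]

@[simp] theorem cart_zero_apply (q : ℝ × ℝ × ℝ) : cart q 0 = q.1 := rfl
@[simp] theorem cart_one_apply (q : ℝ × ℝ × ℝ) : cart q 1 = q.2.1 := rfl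
@[simp] theorem cart_two_apply (q : ℝ × ℝ × ℝ) : cart q 2 = q.2.2 := rfl

theorem norm_sq_eq_coords (z : E3) : ‖z‖ ^ 2 = z 0 ^ 2 + z 1 ^ 2 + z 2 ^ 2 := by
  rw [EuclideanSpace.norm_sq_eq, Fin.sum_univ_three]; simp

theorem measurePreserving_cart : MeasurePreserving cart := by
  have h1 := (volume_preserving_piFinSuccAbove (fun _ : Fin 3 => ℝ) 0).symm
  have h2 := ((MeasurePreserving.id (volume : Measure ℝ)).prod
    (volume_preserving_finTwoArrow ℝ).symm)
  have h3 := (PiLp.volume_preserving_toLp (Fin 3)).comp (h1.comp h2)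
  convert! h3 using 1
  ext q i
  fin_cases i <;> rfl

@[fun_prop]
theorem measurable_cart : Measurable cart := measurePreserving_cart.measurable

theorem lintegral_cart {F : E3 → ℝ≥0∞} (hF : Measurable F) :
    ∫⁻ z, F z = ∫⁻ a, ∫⁻ b, ∫⁻ c, F (cart (a, b, c)) := by
  rw [← measurePreserving_cart.lintegral_comp hF, Measure.volume_eq_prod,
    lintegral_prod _ (by fun_prop)]
  refine lintegral_congr fun a => ?_
  rw [Measure.volume_eq_prod, lintegral_prod _ (by fun_prop)]

theorem lintegral_smul_E3 (F : E3 → ℝ≥0∞) {t : ℝ} (ht : 0 < t) :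
    ∫⁻ z, F (t • z) = ENNReal.ofReal (t⁻¹ ^ 3) * ∫⁻ z, F z := by
  have h : ∫⁻ z, F z ∂(Measure.map (fun z : E3 => t • z) volume) = ∫⁻ z, F (t • z) :=
    (measurableEmbedding_const_smul₀ ht.ne').lintegral_map F
  rw [← h, Measure.map_addHaar_smul _ ht.ne', lintegral_smul_measure]
  simp [abs_of_pos ht]

theorem setLIntegral_Ioi_comp_mul (F : ℝ → ℝ≥0∞) {c : ℝ} (hc : 0 < c) :
    ∫⁻ p in Ioi 0, F p = ENNReal.ofReal c * ∫⁻ t in Ioi 0, F (c * t) := by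
  have himg : (fun t => c * t) '' Ioi 0 = Ioi 0 := by
    ext x; constructor
    · rintro ⟨t, ht, rfl⟩; exact mul_pos hc ht
    · intro hx; exact ⟨x / c, div_pos hx hc, mul_div_cancel₀ x hc.ne'⟩
  have h := lintegral_image_eq_lintegral_abs_deriv_mul (s := Ioi 0) (f := fun t => c * t)
    (f' := fun _ => c) measurableSet_Ioi
    (fun x _ => by simpa using ((hasDerivAt_id x).const_mul c).hasDerivWithinAt)
    (fun x _ y _ h => mul_left_cancel₀ hc.ne' h) F
  rw [himg] at h
  rw [h, abs_of_pos hc, lintegral_const_mul' _ _ ENNReal.ofReal_ne_top]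

theorem lintegral_Ioi_inv_pow_four {r : ℝ} (hr : 0 < r) :
    ∫⁻ t in Ioi r, ENNReal.ofReal (t⁻¹ ^ 4) = ENNReal.ofReal (r⁻¹ ^ 3 / 3) := by
  have e : ∀ t ∈ Ioi r, t⁻¹ ^ 4 = t ^ (-4 : ℝ) := fun t ht => by
    rw [rpow_neg (hr.trans ht).le, inv_pow]; norm_cast
  rw [setLIntegral_congr_fun measurableSet_Ioi
      (fun t ht => by rw [e t ht] : EqOn _ (fun t => ENNReal.ofReal (t ^ (-4 : ℝ))) _),
    ← ofReal_integral_eq_lintegral_ofReal (integrableOn_Ioi_rpow_of_lt (by norm_num) hr)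
      ((ae_restrict_iff' measurableSet_Ioi).2 (.of_forall fun t ht =>
        rpow_nonneg (hr.trans ht).le _)),
    integral_Ioi_rpow_of_lt (by norm_num) hr]
  congr 1
  have : (-4 + 1 : ℝ) = -(3 : ℕ) := by norm_num
  rw [this, rpow_neg hr.le, rpow_natCast, inv_pow]
  norm_num

/-- Polar coordinates: averaging over the directions of the points of the unit ball. -/
theorem lintegral_ball_lintegral_direction {H : E3 → ℝ≥0∞} (hH : Measurable H) :
    ∫⁻ z in Metric.ball (0 : E3) 1, ∫⁻ p in Ioi (0 : ℝ),
      ENNReal.ofReal (p ^ 2) * H (p • (‖z‖⁻¹ • z)) = 3⁻¹ * ∫⁻ v, H v := by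
  have hz : ∀ᵐ z : E3, z ≠ 0 := Measure.ae_ne volume 0
  calc _ = ∫⁻ z in Metric.ball (0 : E3) 1, ∫⁻ t in Ioi (0 : ℝ),
        ENNReal.ofReal (‖z‖ ^ 3 * t ^ 2) * H (t • z) := by
        refine lintegral_congr_ae (ae_restrict_of_ae (hz.mono fun z hz => ?_))
        have hn : 0 < ‖z‖ := norm_pos_iff.2 hz
        simp only
        rw [setLIntegral_Ioi_comp_mul _ hn, ← lintegral_const_mul' _ _ ENNReal.ofReal_ne_top]
        refine lintegral_congr fun t => ?_
        rw [← mul_assoc, ← ENNReal.ofReal_mul hn.le, smul_smul, mul_right_comm,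
          mul_inv_cancel₀ hn.ne', one_mul]
        ring_nf
    _ = ∫⁻ t in Ioi (0 : ℝ), ∫⁻ z in Metric.ball (0 : E3) 1,
        ENNReal.ofReal (‖z‖ ^ 3 * t ^ 2) * H (t • z) :=
        lintegral_lintegral_swap (by fun_prop)
    _ = ∫⁻ t in Ioi (0 : ℝ), ∫⁻ v, (Ioi ‖v‖).indicator
        (fun t => ENNReal.ofReal (t⁻¹ ^ 4)) t * (ENNReal.ofReal (‖v‖ ^ 3) * H v) := by
        -- With v = t z the ball becomes the condition ‖v‖ < t, and the powers of t combine with the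
        -- Jacobian t⁻³ to ‖v‖³ t⁻⁴. After the next exchange the integral of t⁻⁴ over t > ‖v‖ leaves
        -- exactly 1/3.
        refine setLIntegral_congr_fun measurableSet_Ioi fun t (ht : 0 < t) => ?_
        let G : E3 → ℝ≥0∞ := fun v => ENNReal.ofReal (t ^ 3) * ((Ioi ‖v‖).indicator
          (fun t => ENNReal.ofReal (t⁻¹ ^ 4)) t * (ENNReal.ofReal (‖v‖ ^ 3) * H v))
        have e : ∀ z : E3, (Metric.ball (0 : E3) 1).indicator
            (fun z => ENNReal.ofReal (‖z‖ ^ 3 * t ^ 2) * H (t • z)) z = G (t • z) := by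
          intro z
          unfold G
          have hm : z ∈ Metric.ball (0 : E3) 1 ↔ t ∈ Ioi ‖t • z‖ := by
            simp [norm_smul, abs_of_pos ht, ht]
          by_cases h : z ∈ Metric.ball (0 : E3) 1
          · simp only [indicator_of_mem h, indicator_of_mem (hm.1 h)]
            rw [← mul_assoc, ← mul_assoc, ← ENNReal.ofReal_mul (by positivity),
              ← ENNReal.ofReal_mul (by positivity), norm_smul, norm_of_nonneg ht.le]
            congr 2
            field_simp
          · simp only [indicator_of_notMem h, indicator_of_notMem (mt hm.2 h)]
            simp
        rw [← lintegral_indicator measurableSet_ball, lintegral_congr e, lintegral_smul_E3 G ht]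
        unfold G
        rw [lintegral_const_mul' _ _ ENNReal.ofReal_ne_top, ← mul_assoc,
          ← ENNReal.ofReal_mul (by positivity), ← mul_pow, inv_mul_cancel₀ ht.ne']
        simp
    _ = ∫⁻ v, ∫⁻ t in Ioi (0 : ℝ), (Ioi ‖v‖).indicator
        (fun t => ENNReal.ofReal (t⁻¹ ^ 4)) t * (ENNReal.ofReal (‖v‖ ^ 3) * H v) := by
        refine lintegral_lintegral_swap (Measurable.aemeasurable ?_)
        refine Measurable.mul ?_ (by fun_prop)
        have : (fun q : ℝ × E3 => (Ioi ‖q.2‖).indicator (fun t => ENNReal.ofReal (t⁻¹ ^ 4)) q.1) =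
            {q : ℝ × E3 | ‖q.2‖ < q.1}.indicator (fun q => ENNReal.ofReal (q.1⁻¹ ^ 4)) := by
          ext q; simp [indicator]
        change Measurable (fun q : ℝ × E3 =>
          (Ioi ‖q.2‖).indicator (fun t => ENNReal.ofReal (t⁻¹ ^ 4)) q.1)
        rw [this]
        exact Measurable.indicator (by fun_prop) (measurableSet_lt (by fun_prop) (by fun_prop))
    _ = ∫⁻ v, 3⁻¹ * H v := by
        refine lintegral_congr_ae (hz.mono fun v hv => ?_)
        have hn : 0 < ‖v‖ := norm_pos_iff.2 hv
        simp only
        rw [lintegral_mul_const _ ((by fun_prop : Measurable _).indicator measurableSet_Ioi),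
          setLIntegral_indicator measurableSet_Ioi,
          inter_eq_left.2 (Ioi_subset_Ioi hn.le), lintegral_Ioi_inv_pow_four hn, ← mul_assoc,
          ← ENNReal.ofReal_mul (by positivity)]
        have : ‖v‖⁻¹ ^ 3 / 3 * ‖v‖ ^ 3 = 3⁻¹ := by field_simp
        rw [this, ENNReal.ofReal_inv_of_pos (by norm_num)]
        simp
    _ = _ := lintegral_const_mul' _ _ (by simp)

/-! ### Spherical coordinates -/

theorem lintegral_polar {F : ℝ × ℝ → ℝ≥0∞} (hF : Measurable F) :
    ∫⁻ b, ∫⁻ c, F (b, c) = ∫⁻ r in Ioi (0 : ℝ), ∫⁻ ε in Ioo (-π) π,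
      ENNReal.ofReal r * F (r * cos ε, r * sin ε) := by
  have h := lintegral_comp_polarCoord_symm F
  rw [polarCoord_target, Measure.volume_eq_prod, ← Measure.prod_restrict,
    lintegral_prod _ (by simp only [polarCoord_symm_apply, smul_eq_mul]; fun_prop),
    lintegral_prod _ (by fun_prop)] at h
  rw [← h]
  simp

theorem setLIntegral_Ioo_of_periodic {H : ℝ → ℝ≥0∞} {T : ℝ} (hT : 0 < T)
    (hH : Function.Periodic H T) (a b : ℝ) :
    ∫⁻ ε in Ioo a (a + T), H ε = ∫⁻ ε in Ioo b (b + T), H ε := by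
  rw [setLIntegral_congr (Ioo_ae_eq_Ioc (a := a)), setLIntegral_congr (Ioo_ae_eq_Ioc (a := b))]
  refine (isAddFundamentalDomain_Ioc hT a volume).setLIntegral_eq
    (isAddFundamentalDomain_Ioc hT b volume) H fun g x => ?_
  obtain ⟨n, hn⟩ := AddSubgroup.mem_zmultiples_iff.1 g.2
  rw [AddSubgroup.vadd_def, ← hn, vadd_eq_add, add_comm]
  exact hH.zsmul n x

theorem setLIntegral_Ioo_sq :
    ∫⁻ r in Ioo (0 : ℝ) 1, ENNReal.ofReal (r ^ 2) = 3⁻¹ := by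
  rw [setLIntegral_congr Ioo_ae_eq_Ioc, ← ofReal_integral_eq_lintegral_ofReal
    (by
      have : IntervalIntegrable (fun r : ℝ => r ^ 2) volume 0 1 :=
        (by fun_prop : Continuous fun r : ℝ => r ^ 2).intervalIntegrable _ _
      exact (intervalIntegrable_iff_integrableOn_Ioc_of_le zero_le_one).1 this)
    (.of_forall fun r => sq_nonneg r),
    ← intervalIntegral.integral_of_le zero_le_one, integral_pow]
  rw [show ((1 : ℝ) ^ (2 + 1) - 0 ^ (2 + 1)) / ((2 : ℕ) + 1) = 3⁻¹ by norm_num,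
    ENNReal.ofReal_inv_of_pos (by norm_num)]
  simp

/-- Spherical coordinates of a unit vector around the first coordinate axis. -/
noncomputable def sph (θ ε : ℝ) : E3 := cart (cos θ, sin θ * cos ε, sin θ * sin ε)

theorem norm_sph (θ ε : ℝ) : ‖sph θ ε‖ = 1 := by
  have : ‖sph θ ε‖ ^ 2 = 1 := by
    rw [norm_sq_eq_coords]
    simp only [sph, cart_zero_apply, cart_one_apply, cart_two_apply]
    linear_combination sin θ ^ 2 * sin_sq_add_cos_sq ε + sin_sq_add_cos_sq θ
  exact (pow_eq_one_iff_of_nonneg (norm_nonneg _) two_ne_zero).1 this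

/-- A spherical integral is three times the integral over the solid ball of the function extended by
homogeneity, as ∫₀¹ r² dr = 1/3; this makes a surface measure unnecessary. Two planar polar
substitutions give spherical coordinates, first with the azimuth ε and then with the polar angle θ.
-/
theorem lintegral_sph_le {F : E3 → ℝ≥0∞} (hF : Measurable F) :
    ∫⁻ ε in Ioo 0 (2 * π), ∫⁻ θ in Ioo 0 (π / 2), ENNReal.ofReal (sin θ) * F (sph θ ε) ≤
      3 * ∫⁻ z in Metric.ball (0 : E3) 1 ∩ {z | 0 < z 0}, F (‖z‖⁻¹ • z) := by
  set S : Set E3 := Metric.ball (0 : E3) 1 ∩ {z | 0 < z 0} with hS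
  have hSm : MeasurableSet S := measurableSet_ball.inter (measurableSet_lt (by fun_prop)
    (by fun_prop))
  set G : E3 → ℝ≥0∞ := S.indicator fun z => F (‖z‖⁻¹ • z) with hG
  have hGm : Measurable G := Measurable.indicator (by fun_prop) hSm
  have hper : ∫⁻ ε in Ioo 0 (2 * π), ∫⁻ θ in Ioo 0 (π / 2), ENNReal.ofReal (sin θ) * F (sph θ ε)
      = ∫⁻ ε in Ioo (-π) π, ∫⁻ θ in Ioo 0 (π / 2), ENNReal.ofReal (sin θ) * F (sph θ ε) := by
    have := setLIntegral_Ioo_of_periodic (H := fun ε => ∫⁻ θ in Ioo 0 (π / 2),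
      ENNReal.ofReal (sin θ) * F (sph θ ε)) two_pi_pos (fun ε => by simp [sph]) 0 (-π)
    rw [zero_add, show -π + 2 * π = π by ring] at this
    exact this
  have e1 : ∫⁻ z in S, F (‖z‖⁻¹ • z) = ∫⁻ ε in Ioo (-π) π, ∫⁻ a, ∫⁻ ρ in Ioi (0 : ℝ),
      ENNReal.ofReal ρ * G (cart (a, ρ * cos ε, ρ * sin ε)) := by
    rw [← lintegral_indicator hSm, ← hG, lintegral_cart hGm]
    calc _ = ∫⁻ a, ∫⁻ ρ in Ioi (0 : ℝ), ∫⁻ ε in Ioo (-π) π,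
          ENNReal.ofReal ρ * G (cart (a, ρ * cos ε, ρ * sin ε)) :=
          lintegral_congr fun a => lintegral_polar (F := fun q => G (cart (a, q.1, q.2)))
            (by fun_prop)
      _ = ∫⁻ a, ∫⁻ ε in Ioo (-π) π, ∫⁻ ρ in Ioi (0 : ℝ),
          ENNReal.ofReal ρ * G (cart (a, ρ * cos ε, ρ * sin ε)) :=
          lintegral_congr fun a => lintegral_lintegral_swap (by fun_prop)
      _ = _ := by
          refine lintegral_lintegral_swap (Measurable.aemeasurable ?_)
          refine Measurable.lintegral_prod_right' (f := fun w : (ℝ × ℝ) × ℝ =>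
            ENNReal.ofReal w.2 * G (cart (w.1.1, w.2 * cos w.1.2, w.2 * sin w.1.2))) ?_
          fun_prop
  have e2 : ∀ ε, 3⁻¹ * ∫⁻ θ in Ioo 0 (π / 2), ENNReal.ofReal (sin θ) * F (sph θ ε) ≤
      ∫⁻ a, ∫⁻ ρ in Ioi (0 : ℝ), ENNReal.ofReal ρ * G (cart (a, ρ * cos ε, ρ * sin ε)) := by
    intro ε
    set Φ : ℝ × ℝ → ℝ≥0∞ := fun q => (Ioi (0 : ℝ)).indicator
      (fun ρ => ENNReal.ofReal ρ * G (cart (q.1, ρ * cos ε, ρ * sin ε))) q.2 with hΦ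
    have hΦ' : Φ = {q : ℝ × ℝ | 0 < q.2}.indicator
      (fun q => ENNReal.ofReal q.2 * G (cart (q.1, q.2 * cos ε, q.2 * sin ε))) := by
      ext q; simp [hΦ, indicator]
    have hΦm : Measurable Φ := by
      rw [hΦ']
      exact Measurable.indicator (by fun_prop) (measurableSet_lt (by fun_prop) (by fun_prop))
    have : ∫⁻ a, ∫⁻ ρ in Ioi (0 : ℝ), ENNReal.ofReal ρ * G (cart (a, ρ * cos ε, ρ * sin ε))
        = ∫⁻ a, ∫⁻ ρ, Φ (a, ρ) :=
      lintegral_congr fun a => (lintegral_indicator measurableSet_Ioi _).symm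
    rw [this, lintegral_polar hΦm]
    calc _ = ∫⁻ r in Ioo (0 : ℝ) 1, ∫⁻ θ in Ioo 0 (π / 2),
          ENNReal.ofReal (r ^ 2) * (ENNReal.ofReal (sin θ) * F (sph θ ε)) := by
          rw [← setLIntegral_Ioo_sq, ← lintegral_mul_const _ (by fun_prop)]
          exact lintegral_congr fun r => (lintegral_const_mul' _ _ ENNReal.ofReal_ne_top).symm
      -- Only an inequality is needed, so the angles outside (0, π/2) and the radii beyond 1 are
      -- added freely. The Jacobians r and ρ = r sin θ multiply to r² sin θ.
      _ ≤ ∫⁻ r in Ioo (0 : ℝ) 1, ∫⁻ θ in Ioo (-π) π,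
          ENNReal.ofReal r * Φ (r * cos θ, r * sin θ) := by
          refine setLIntegral_mono' measurableSet_Ioo fun r hr => ?_
          refine le_trans (setLIntegral_mono' measurableSet_Ioo fun θ hθ => ?_)
            (lintegral_mono_set (Ioo_subset_Ioo (neg_nonpos.2 pi_pos.le)
              (half_le_self pi_pos.le)))
          have hs : 0 < sin θ := sin_pos_of_pos_of_lt_pi hθ.1 (hθ.2.trans (half_lt_self pi_pos))
          have hc : 0 < cos θ := cos_pos_of_mem_Ioo ⟨by linarith [hθ.1, pi_pos], hθ.2⟩
          have hz : cart (r * cos θ, r * sin θ * cos ε, r * sin θ * sin ε) = r • sph θ ε := by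
            ext i; fin_cases i <;> simp [sph, cart, mul_assoc]
          have hn : ‖r • sph θ ε‖ = r := by
            rw [norm_smul, norm_sph, mul_one, norm_of_nonneg hr.1.le]
          have hmem : r • sph θ ε ∈ S := by
            refine ⟨by simpa [hn] using hr.2, ?_⟩
            simpa [sph] using mul_pos hr.1 hc
          rw [hΦ]
          simp only
          rw [indicator_of_mem (mem_Ioi.2 (mul_pos hr.1 hs)), hz, hG, indicator_of_mem hmem, hn, smul_smul,
            inv_mul_cancel₀ hr.1.ne', one_smul, ← mul_assoc, ← mul_assoc,
            ← ENNReal.ofReal_mul (sq_nonneg r), ← ENNReal.ofReal_mul hr.1.le]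
          exact le_of_eq (by ring_nf)
      _ ≤ _ := lintegral_mono_set fun r hr => hr.1
  rw [hper, e1]
  calc _ = 3 * ∫⁻ ε in Ioo (-π) π, 3⁻¹ * ∫⁻ θ in Ioo 0 (π / 2),
        ENNReal.ofReal (sin θ) * F (sph θ ε) := by
        rw [lintegral_const_mul' _ _ (by simp), ← mul_assoc,
          ENNReal.mul_inv_cancel (by simp) (by simp), one_mul]
    _ ≤ _ := by gcongr with ε; exact e2 ε

/-! ### The reflection that carries the axis to a given direction -/

/-- The reflection that exchanges the first coordinate vector and `V / |V|`. -/
noncomputable def axisRefl (V : E3) : E3 ≃ₗᵢ[ℝ] E3 := (ℝ ∙ (axis - ‖V‖⁻¹ • V))ᗮ.reflection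

theorem apse_eq (V : E3) (θ ε : ℝ) : apse V θ ε = axisRefl V (sph θ ε) := rfl

theorem axisRefl_axisRefl (V x : E3) : axisRefl V (axisRefl V x) = x :=
  Submodule.reflection_reflection _ x

theorem norm_axis : ‖axis‖ = 1 := by simp [axis]

theorem inner_axis (x : E3) : inner ℝ axis x = x 0 := by
  simp [axis, EuclideanSpace.inner_single_left]

theorem axisRefl_axis {V : E3} (hV : V ≠ 0) : axisRefl V axis = ‖V‖⁻¹ • V := by
  apply Submodule.reflection_sub
  rw [norm_axis, norm_smul, norm_inv, norm_norm, inv_mul_cancel₀ (norm_ne_zero_iff.2 hV)]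

theorem axisRefl_direction {V : E3} (hV : V ≠ 0) : axisRefl V (‖V‖⁻¹ • V) = axis := by
  rw [← axisRefl_axis hV, axisRefl_axisRefl]

theorem axisRefl_self {V : E3} (hV : V ≠ 0) : axisRefl V V = ‖V‖ • axis := by
  rw [← axisRefl_direction hV, ← LinearIsometryEquiv.map_smul, smul_smul,
    mul_inv_cancel₀ (norm_ne_zero_iff.2 hV), one_smul]

theorem inner_axisRefl (V x y : E3) :
    inner ℝ (axisRefl V x) y = inner ℝ x (axisRefl V y) := by
  conv_lhs => rw [← axisRefl_axisRefl V y]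
  exact LinearIsometryEquiv.inner_map_map _ _ _

theorem inner_direction_axisRefl {V : E3} (hV : V ≠ 0) (x : E3) :
    inner ℝ (axisRefl V x) (‖V‖⁻¹ • V) = x 0 := by
  rw [inner_axisRefl, axisRefl_direction hV, real_inner_comm, inner_axis]

/-- Makes joint measurability in `V` and `x` visible. If `V` already points along the axis, the
division by zero yields the identity, as it should. -/
theorem axisRefl_apply (V x : E3) : axisRefl V x =
    x - (2 * (inner ℝ (axis - ‖V‖⁻¹ • V) x / ‖axis - ‖V‖⁻¹ • V‖ ^ 2)) •
      (axis - ‖V‖⁻¹ • V) := by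
  unfold axisRefl
  rw [Submodule.reflection_orthogonal_apply, Submodule.reflection_singleton_apply]
  rw [neg_sub, ← Nat.cast_smul_eq_nsmul ℝ, smul_smul]
  simp

@[fun_prop]
theorem measurable_axisRefl {X : Type*} [MeasurableSpace X] {f g : X → E3} (hf : Measurable f)
    (hg : Measurable g) : Measurable fun x => axisRefl (f x) (g x) := by
  simp only [axisRefl_apply]
  fun_prop

theorem measurePreserving_axisRefl (V : E3) : MeasurePreserving (axisRefl V) :=
  (axisRefl V).measurePreserving

theorem lintegral_axisRefl (V : E3) (F : E3 → ℝ≥0∞) :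
    ∫⁻ x, F (axisRefl V x) = ∫⁻ x, F x :=
  (measurePreserving_axisRefl V).lintegral_comp_emb
    (axisRefl V).toHomeomorph.measurableEmbedding F

/-- The apse line is distributed over a hemisphere. -/
theorem lintegral_apse_le {F : E3 → ℝ≥0∞} (hF : Measurable F) {V : E3} (hV : V ≠ 0) :
    ∫⁻ ε in Ioo 0 (2 * π), ∫⁻ θ in Ioo 0 (π / 2), ENNReal.ofReal (sin θ) * F (apse V θ ε) ≤
      3 * ∫⁻ z in Metric.ball (0 : E3) 1 ∩ {z | 0 < inner ℝ V z}, F (‖z‖⁻¹ • z) := by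
  refine (lintegral_sph_le (F := fun z => F (axisRefl V z)) (by fun_prop)).trans_eq ?_
  have hm : ∀ W : E3, MeasurableSet (Metric.ball (0 : E3) 1 ∩ {z | 0 < inner ℝ W z}) := fun W =>
    measurableSet_ball.inter (measurableSet_lt (by fun_prop) (by fun_prop))
  have hm' := hm axis
  simp only [inner_axis] at hm'
  rw [← lintegral_indicator hm', ← lintegral_indicator (hm V),
    ← lintegral_axisRefl V (indicator _ _)]
  congr 2 with z
  have h1 : (axisRefl V z) 0 = ‖V‖⁻¹ * inner ℝ V z := by
    rw [← inner_axis, ← inner_axisRefl, axisRefl_axis hV, real_inner_smul_left]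
  have hn := norm_pos_iff.2 hV
  simp [indicator, h1, hn, axisRefl_axisRefl]

/-! ### Gaussian integrals -/

theorem lintegral_gaussian {c : ℝ} (hc : 0 < c) :
    ∫⁻ t : ℝ, ENNReal.ofReal (exp (-(c * t ^ 2))) = ENNReal.ofReal (√(π / c)) := by
  have h := ofReal_integral_eq_lintegral_ofReal (integrable_exp_neg_mul_sq hc)
    (.of_forall fun t => (exp_pos _).le)
  rw [integral_gaussian] at h
  rw [h]
  simp

/-- The one-dimensional weight that dominates the integrand over a line orthogonal to the apse
line. -/
noncomputable def lineWeight (b w : ℝ) : ℝ := (1 + |w| ^ (-(1 / 2) : ℝ)) * exp (-((b + w) ^ 2 / 2))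

theorem lineWeight_nonneg (b w : ℝ) : 0 ≤ lineWeight b w := by unfold lineWeight; positivity

/-- The bound is uniform in the shift: away from the origin the weight is at most twice a translated
Gaussian, and near it the singularity |w|^(-1/2) is integrable and does not depend on `b`. -/
theorem exists_lintegral_lineWeight_le :
    ∃ D : ℝ≥0∞, D ≠ ∞ ∧ ∀ b, ∫⁻ w, ENNReal.ofReal (lineWeight b w) ≤ D := by
  set G : ℝ → ℝ≥0∞ := (Ioc (0 : ℝ) 1).indicator fun w => ENNReal.ofReal (w ^ (-(1 / 2) : ℝ)) with hG
  have hGm : Measurable G := Measurable.indicator (by fun_prop) measurableSet_Ioc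
  have hGfin : ∫⁻ w, G w ≠ ∞ := by
    rw [hG, lintegral_indicator measurableSet_Ioc]
    have h : IntegrableOn (fun w : ℝ => w ^ (-(1 / 2) : ℝ)) (Ioc 0 1) :=
      (intervalIntegrable_iff_integrableOn_Ioc_of_le zero_le_one).1
        (intervalIntegral.intervalIntegrable_rpow' (by norm_num))
    exact (Integrable.lintegral_lt_top h).ne
  refine ⟨2 * ENNReal.ofReal (√(π / 2⁻¹)) + ((∫⁻ w, G w) + ∫⁻ w, G w), ?_, fun b => ?_⟩
  · finiteness
  calc _ ≤ ∫⁻ w, (2 * ENNReal.ofReal (exp (-(2⁻¹ * (b + w) ^ 2))) + (G w + G (-w))) := by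
        refine lintegral_mono fun w => ?_
        have he : exp (-((b + w) ^ 2 / 2)) ≤ 1 := exp_le_one_iff.2 (by nlinarith [sq_nonneg (b + w)])
        have hee : exp (-((b + w) ^ 2 / 2)) = exp (-(2⁻¹ * (b + w) ^ 2)) := by ring_nf
        have key : ∀ y : ℝ≥0∞, |w| ^ (-(1 / 2) : ℝ) ≤ 1 ∨
            ENNReal.ofReal (|w| ^ (-(1 / 2) : ℝ)) ≤ y →
            ENNReal.ofReal (lineWeight b w) ≤
              2 * ENNReal.ofReal (exp (-(2⁻¹ * (b + w) ^ 2))) + y := by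
          rintro y (h | h)
          · refine le_trans ?_ le_self_add
            rw [← ENNReal.ofReal_ofNat, ← ENNReal.ofReal_mul (by norm_num)]
            refine ENNReal.ofReal_le_ofReal ?_
            unfold lineWeight
            rw [hee]
            gcongr
            linarith
          · have h2 : lineWeight b w ≤
                2 * exp (-(2⁻¹ * (b + w) ^ 2)) + |w| ^ (-(1 / 2) : ℝ) := by
              unfold lineWeight
              have : 0 ≤ |w| ^ (-(1 / 2) : ℝ) := by positivity
              rw [← hee]
              nlinarith [exp_pos (-((b + w) ^ 2 / 2))]
            refine (ENNReal.ofReal_le_ofReal h2).trans ?_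
            rw [ENNReal.ofReal_add (by positivity) (by positivity),
              ENNReal.ofReal_mul (by norm_num), ENNReal.ofReal_ofNat]
            gcongr
        apply key
        by_cases hw : 1 ≤ |w|
        · left; exact rpow_le_one_of_one_le_of_nonpos hw (by norm_num)
        push Not at hw
        rcases lt_trichotomy w 0 with h | h | h
        · right
          have : G (-w) = ENNReal.ofReal (|w| ^ (-(1 / 2) : ℝ)) := by
            rw [hG, indicator_of_mem (mem_Ioc.2
              ⟨by linarith, by rw [abs_of_neg h] at hw; exact hw.le⟩),
              abs_of_neg h]
          rw [this]; exact le_add_self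
        -- At w = 0 the convention `0 ^ (-1/2) = 0` removes the singular term.
        · left
          rw [h, abs_zero, zero_rpow (by norm_num)]; exact zero_le_one
        · right
          have : G w = ENNReal.ofReal (|w| ^ (-(1 / 2) : ℝ)) := by
            rw [hG, indicator_of_mem (mem_Ioc.2
              ⟨h, by rw [abs_of_pos h] at hw; exact hw.le⟩),
              abs_of_pos h]
          rw [this]; exact le_self_add
    _ = _ := by
        rw [lintegral_add_left (by fun_prop), lintegral_add_left hGm,
          lintegral_const_mul _ (by fun_prop),
          lintegral_add_left_eq_self (fun w => ENNReal.ofReal (exp (-(2⁻¹ * w ^ 2)))) b,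
          lintegral_gaussian (by norm_num), (Measure.measurePreserving_neg volume).lintegral_comp hGm]

/-- Only directions nearly orthogonal to ζ contribute, a band of width about 1/|ζ|. After reflecting
ζ onto the first axis and enlarging the ball to a cube, this is a one-dimensional Gaussian integral,
at most both 2 and √(4π)/|ζ|. -/
theorem exists_lintegral_ball_exp_le :
    ∃ D : ℝ≥0∞, D ≠ ∞ ∧ ∀ ζ : E3, ∫⁻ z in Metric.ball (0 : E3) 1,
      ENNReal.ofReal (exp (-(inner ℝ ζ z ^ 2 / 4))) ≤ D * ENNReal.ofReal ((1 + ‖ζ‖)⁻¹) := by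
  have line : ∀ s : ℝ, 0 ≤ s → ∫⁻ a in Ioo (-1 : ℝ) 1, ENNReal.ofReal (exp (-((s * a) ^ 2 / 4)))
      ≤ (2 + ENNReal.ofReal (√(4 * π))) * ENNReal.ofReal ((1 + s)⁻¹) := by
    intro s hs
    have h1 : ∫⁻ a in Ioo (-1 : ℝ) 1, ENNReal.ofReal (exp (-((s * a) ^ 2 / 4))) ≤ 2 := by
      calc _ ≤ ∫⁻ a in Ioo (-1 : ℝ) 1, 1 := by
            refine lintegral_mono fun a => ?_
            rw [← ENNReal.ofReal_one]
            exact ENNReal.ofReal_le_ofReal (exp_le_one_iff.2 (by nlinarith [sq_nonneg (s * a)]))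
        _ = 2 := by simp; norm_num
    have h2 : ENNReal.ofReal s * ∫⁻ a in Ioo (-1 : ℝ) 1,
        ENNReal.ofReal (exp (-((s * a) ^ 2 / 4))) ≤ ENNReal.ofReal (√(4 * π)) := by
      rcases hs.eq_or_lt with rfl | hs
      · simp
      calc _ ≤ ENNReal.ofReal s * ∫⁻ a : ℝ, ENNReal.ofReal (exp (-(s ^ 2 / 4 * a ^ 2))) := by
            refine mul_le_mul_right ((setLIntegral_le_lintegral _ _).trans_eq ?_) _
            ring_nf
        _ = _ := by
            rw [lintegral_gaussian (by positivity), ← ENNReal.ofReal_mul hs.le]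
            congr 1
            rw [← sqrt_sq hs.le, ← sqrt_mul (by positivity)]
            congr 1
            rw [sqrt_sq hs.le]
            field_simp
    rw [ENNReal.ofReal_inv_of_pos (by positivity), ← div_eq_mul_inv,
      ENNReal.le_div_iff_mul_le (by simp) (by simp),
      ENNReal.ofReal_add zero_le_one hs, mul_add, mul_comm _ (ENNReal.ofReal s)]
    gcongr
    simpa using h1
  refine ⟨4 * (2 + ENNReal.ofReal (√(4 * π))), by finiteness, fun ζ => ?_⟩
  have hin : ∀ z, inner ℝ ζ (axisRefl ζ z) = ‖ζ‖ * z 0 := by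
    intro z
    rcases eq_or_ne ζ 0 with rfl | h
    · simp
    · rw [real_inner_comm, inner_axisRefl, axisRefl_self h, inner_smul_right, real_inner_comm,
        inner_axis]
  rw [← lintegral_indicator measurableSet_ball, ← lintegral_axisRefl ζ]
  calc _ ≤ ∫⁻ z : E3, (Ioo (-1 : ℝ) 1).indicator
          (fun a => ENNReal.ofReal (exp (-((‖ζ‖ * a) ^ 2 / 4)))) (z 0) *
            ((Ioo (-1 : ℝ) 1).indicator 1 (z 1) * (Ioo (-1 : ℝ) 1).indicator 1 (z 2)) := by
        refine lintegral_mono fun z => ?_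
        by_cases hz : ‖z‖ < 1
        · have hc : ∀ i, z i ∈ Ioo (-1 : ℝ) 1 := fun i =>
            abs_lt.1 ((PiLp.norm_apply_le z i).trans_lt hz)
          rw [indicator_of_mem (hc 0), indicator_of_mem (hc 1), indicator_of_mem (hc 2),
            indicator_of_mem (by simpa using hz), hin]
          simp
        · rw [indicator_of_notMem (by simpa using hz)]; simp
    _ = (∫⁻ a in Ioo (-1 : ℝ) 1, ENNReal.ofReal (exp (-((‖ζ‖ * a) ^ 2 / 4)))) * (2 * 2) := by
        have h2 : ∫⁻ a, (Ioo (-1 : ℝ) 1).indicator (1 : ℝ → ℝ≥0∞) a = 2 := by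
          rw [lintegral_indicator_one measurableSet_Ioo]; simp; norm_num
        have hm : Measurable ((Ioo (-1 : ℝ) 1).indicator (1 : ℝ → ℝ≥0∞)) :=
          measurable_one.indicator measurableSet_Ioo
        have hm' : Measurable ((Ioo (-1 : ℝ) 1).indicator
            (fun a => ENNReal.ofReal (exp (-((‖ζ‖ * a) ^ 2 / 4))))) :=
          Measurable.indicator (by fun_prop) measurableSet_Ioo
        rw [lintegral_cart (by fun_prop)]
        simp only [cart_zero_apply, cart_one_apply, cart_two_apply]
        rw [← lintegral_indicator measurableSet_Ioo, ← lintegral_mul_const _ hm']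
        refine lintegral_congr fun a => ?_
        simp_rw [← h2]
        rw [← lintegral_mul_const _ hm, ← lintegral_const_mul _ (by fun_prop)]
        refine lintegral_congr fun b => ?_
        rw [← lintegral_const_mul _ hm, ← lintegral_const_mul _ (by fun_prop)]
    _ ≤ (2 + ENNReal.ofReal (√(4 * π))) * ENNReal.ofReal ((1 + ‖ζ‖)⁻¹) * (2 * 2) := by
        gcongr; exact line _ (norm_nonneg _)
    _ = _ := by ring

/-! ### The gain term -/

/-- Used to absorb polynomial factors into a small part of a Gaussian exponent. -/
theorem one_add_le_two_mul_exp (y : ℝ) : 1 + y ≤ 2 * exp (y ^ 2 / 4) := by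
  nlinarith [add_one_le_exp (y ^ 2 / 4), sq_nonneg (y - 1)]

/-- By x² + y² ≥ |x||y|, the planar singularity splits into a product of two integrable
one-dimensional ones, so no polar coordinates are needed in the plane. -/
theorem inv_norm_le_rpow_mul_rpow {n x y : ℝ} (hx : x ≠ 0) (hy : y ≠ 0) (hn : 0 < n)
    (hn2 : x ^ 2 + y ^ 2 ≤ n ^ 2) :
    n⁻¹ ≤ |x| ^ (-(1 / 2) : ℝ) * |y| ^ (-(1 / 2) : ℝ) := by
  have hx' := abs_pos.2 hx
  have hy' := abs_pos.2 hy
  rw [← mul_rpow hx'.le hy'.le, rpow_neg (by positivity), ← sqrt_eq_rpow]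
  refine inv_anti₀ (by positivity) ?_
  rw [sqrt_le_left hn.le]
  nlinarith [sq_nonneg (|x| - |y|), sq_abs x, sq_abs y]

/-- In a frame whose first axis is ω, the triples (a, b, c) and (p, x, y) are the coordinates of ζ
and V, and s, n are their norms. If n is much smaller than s, then ζ_* or ζ_*' is large and the
Gaussian pays for replacing n by 1 + s. -/
theorem gain_weight_le {γ : ℝ} (h0 : 0 ≤ γ) (h1 : γ < 1) {s n a b c p x y : ℝ}
    (hs : 0 ≤ s) (hs2 : s ^ 2 = a ^ 2 + b ^ 2 + c ^ 2) (hn : 0 < n)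
    (hn2 : n ^ 2 = p ^ 2 + x ^ 2 + y ^ 2) (hx : x ≠ 0) (hy : y ≠ 0) :
    exp (-(((a + p) ^ 2 + (b + x) ^ 2 + (c + y) ^ 2 + (a ^ 2 + (b + x) ^ 2 + (c + y) ^ 2)) / 2)) *
      n ^ (γ - 1) ≤
    16 * (1 + s) ^ (γ - 1) * exp (-(((a + p) ^ 2 + a ^ 2) / 4)) *
      (lineWeight b x * lineWeight c y) := by
  set X := |x| ^ (-(1 / 2) : ℝ)
  set Y := |y| ^ (-(1 / 2) : ℝ)
  have hX : 0 ≤ X := by positivity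
  have hY : 0 ≤ Y := by positivity
  have hXY : n⁻¹ ≤ X * Y := inv_norm_le_rpow_mul_rpow hx hy hn (by nlinarith [sq_nonneg p])
  have hsle : s ≤ |a| + (|b + x| + |x|) + (|c + y| + |y|) := by
    have hb : |b| ≤ |b + x| + |x| := by simpa using abs_sub (b + x) x
    have hc : |c| ≤ |c + y| + |y| := by simpa using abs_sub (c + y) y
    have : s ≤ |a| + |b| + |c| := by
      refine abs_le_of_sq_le_sq' ?_ (by positivity) |>.2
      nlinarith [sq_abs a, sq_abs b, sq_abs c, mul_nonneg (abs_nonneg a) (abs_nonneg b),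
        mul_nonneg (abs_nonneg a) (abs_nonneg c), mul_nonneg (abs_nonneg b) (abs_nonneg c)]
    linarith
  have hxn : |x| ≤ n := abs_le_of_sq_le_sq (by nlinarith [sq_nonneg p, sq_nonneg y]) hn.le
  have hyn : |y| ≤ n := abs_le_of_sq_le_sq (by nlinarith [sq_nonneg p, sq_nonneg x]) hn.le
  set T := (1 + |a|) * ((1 + |b + x|) * (1 + |c + y|)) * (2 * ((1 + X) * (1 + Y))) with hT
  have hP : 1 + |a| + |b + x| + |c + y| ≤ (1 + |a|) * ((1 + |b + x|) * (1 + |c + y|)) := by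
    have := abs_nonneg a; have := abs_nonneg (b + x); have := abs_nonneg (c + y)
    have h3 : 1 + |b + x| + |c + y| ≤ (1 + |b + x|) * (1 + |c + y|) := by nlinarith
    nlinarith
  have hP1 : 1 ≤ (1 + |a|) * ((1 + |b + x|) * (1 + |c + y|)) :=
    le_trans (by linarith [abs_nonneg a, abs_nonneg (b + x), abs_nonneg (c + y)]) hP
  have hQ : 2 + n⁻¹ ≤ 2 * ((1 + X) * (1 + Y)) := by nlinarith [inv_pos.2 hn, mul_nonneg hX hY]
  have hT1 : 1 ≤ T := by
    have := inv_pos.2 hn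
    nlinarith
  have ht : (1 + s) / n ≤ T := by
    calc (1 + s) / n ≤ (1 + |a| + |b + x| + |c + y| + 2 * n) / n :=
          (div_le_div_iff_of_pos_right hn).2 (by linarith)
      _ = (1 + |a| + |b + x| + |c + y|) * n⁻¹ + 2 := by field_simp
      _ ≤ ((1 + |a|) * ((1 + |b + x|) * (1 + |c + y|))) * (2 + n⁻¹) := by
          have := mul_le_mul_of_nonneg_right hP (inv_pos.2 hn).le
          linarith
      _ ≤ T := by rw [hT]; gcongr
  -- The quotient of the two powers is ((1+s)/n)^(1-γ). Its base is at most `T`, and since `T ≥ 1`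
  -- the exponent 1 - γ may be raised to 1.
  have hpow : n ^ (γ - 1) ≤ (1 + s) ^ (γ - 1) * T := by
    have e : n ^ (γ - 1) = (1 + s) ^ (γ - 1) * ((1 + s) / n) ^ (1 - γ) := by
      rw [div_rpow (by positivity) hn.le, show γ - 1 = -(1 - γ) by ring, rpow_neg hn.le,
        rpow_neg (by positivity : 0 ≤ 1 + s)]
      have : (1 + s) ^ (1 - γ) ≠ 0 := by positivity
      field_simp
    rw [e]
    gcongr
    calc ((1 + s) / n) ^ (1 - γ) ≤ T ^ (1 - γ) := by gcongr
      _ ≤ T ^ (1 : ℝ) := rpow_le_rpow_of_exponent_le hT1 (by linarith)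
      _ = T := rpow_one T
  -- Three factors 2 come from `one_add_le_two_mul_exp`, the fourth is the one in `T`.
  have hTe : T ≤ 16 * (exp (a ^ 2 / 4) * (exp ((b + x) ^ 2 / 4) * exp ((c + y) ^ 2 / 4))) *
      ((1 + X) * (1 + Y)) := by
    have ea := one_add_le_two_mul_exp |a|
    have eb := one_add_le_two_mul_exp |b + x|
    have ec := one_add_le_two_mul_exp |c + y|
    rw [sq_abs] at ea eb ec
    calc T ≤ (2 * exp (a ^ 2 / 4)) * ((2 * exp ((b + x) ^ 2 / 4)) * (2 * exp ((c + y) ^ 2 / 4))) *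
          (2 * ((1 + X) * (1 + Y))) := by rw [hT]; gcongr
      _ = _ := by ring
  have hE : exp (-(((a + p) ^ 2 + (b + x) ^ 2 + (c + y) ^ 2 +
      (a ^ 2 + (b + x) ^ 2 + (c + y) ^ 2)) / 2)) *
      (exp (a ^ 2 / 4) * (exp ((b + x) ^ 2 / 4) * exp ((c + y) ^ 2 / 4))) ≤
      exp (-(((a + p) ^ 2 + a ^ 2) / 4)) *
        (exp (-((b + x) ^ 2 / 2)) * exp (-((c + y) ^ 2 / 2))) := by
    simp only [← exp_add]
    refine exp_le_exp.2 ?_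
    linarith [sq_nonneg (a + p), sq_nonneg (b + x), sq_nonneg (c + y)]
  calc _ ≤ exp (-(((a + p) ^ 2 + (b + x) ^ 2 + (c + y) ^ 2 +
        (a ^ 2 + (b + x) ^ 2 + (c + y) ^ 2)) / 2)) * ((1 + s) ^ (γ - 1) *
        (16 * (exp (a ^ 2 / 4) * (exp ((b + x) ^ 2 / 4) * exp ((c + y) ^ 2 / 4))) *
        ((1 + X) * (1 + Y)))) := by
        gcongr
        exact hpow.trans (by gcongr)
    _ = 16 * (1 + s) ^ (γ - 1) * (exp (-(((a + p) ^ 2 + (b + x) ^ 2 + (c + y) ^ 2 +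
        (a ^ 2 + (b + x) ^ 2 + (c + y) ^ 2)) / 2)) *
        (exp (a ^ 2 / 4) * (exp ((b + x) ^ 2 / 4) * exp ((c + y) ^ 2 / 4)))) *
        ((1 + X) * (1 + Y)) := by ring
    _ ≤ 16 * (1 + s) ^ (γ - 1) * (exp (-(((a + p) ^ 2 + a ^ 2) / 4)) *
        (exp (-((b + x) ^ 2 / 2)) * exp (-((c + y) ^ 2 / 2)))) * ((1 + X) * (1 + Y)) := by
        gcongr
    _ = _ := by unfold lineWeight; ring

/-- The weight of the gain term, as a function of the relative velocity and the apse line. -/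
noncomputable def gainWeight (γ : ℝ) (ζ V ω : E3) : ℝ :=
  exp (-((‖ζ + V‖ ^ 2 + ‖ζ + V - inner ℝ V ω • ω‖ ^ 2) / 2)) * ‖V‖ ^ (γ - 1) * inner ℝ V ω

@[fun_prop]
theorem measurable_gainWeight (γ : ℝ) {X : Type*} [MeasurableSpace X] {f g h : X → E3}
    (hf : Measurable f) (hg : Measurable g) (hh : Measurable h) :
    Measurable fun x => gainWeight γ (f x) (g x) (h x) := by
  unfold gainWeight; fun_prop

theorem gainWeight_axisRefl_le {γ : ℝ} (h0 : 0 ≤ γ) (h1 : γ < 1) (ζ : E3) {z : E3} (hz : z ≠ 0)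
    {p x y : ℝ} (hp : 0 < p) (hx : x ≠ 0) (hy : y ≠ 0) :
    gainWeight γ ζ (axisRefl z (cart (p, x, y))) (‖z‖⁻¹ • z) ≤
      16 * (1 + ‖ζ‖) ^ (γ - 1) *
        (p * exp (-(((inner ℝ ζ (‖z‖⁻¹ • z) + p) ^ 2 + inner ℝ ζ (‖z‖⁻¹ • z) ^ 2) / 4))) *
        (lineWeight (axisRefl z ζ 1) x * lineWeight (axisRefl z ζ 2) y) := by
  set q := axisRefl z ζ with hq
  have hζ : ζ = axisRefl z q := (axisRefl_axisRefl z ζ).symm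
  have ha : inner ℝ ζ (‖z‖⁻¹ • z) = q 0 := by rw [hζ, inner_direction_axisRefl hz]
  have hi : inner ℝ (axisRefl z (cart (p, x, y))) (‖z‖⁻¹ • z) = p :=
    inner_direction_axisRefl hz _
  have e1 : ‖ζ + axisRefl z (cart (p, x, y))‖ ^ 2 =
      (q 0 + p) ^ 2 + (q 1 + x) ^ 2 + (q 2 + y) ^ 2 := by
    rw [hζ, ← map_add, LinearIsometryEquiv.norm_map, norm_sq_eq_coords]; simp
  have e2 : ‖ζ + axisRefl z (cart (p, x, y)) - p • (‖z‖⁻¹ • z)‖ ^ 2 =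
      q 0 ^ 2 + (q 1 + x) ^ 2 + (q 2 + y) ^ 2 := by
    rw [← axisRefl_axis hz, hζ, ← map_smul, ← map_add, ← map_sub,
      LinearIsometryEquiv.norm_map, norm_sq_eq_coords]
    simp [axis]
  have e3 : ‖ζ‖ ^ 2 = q 0 ^ 2 + q 1 ^ 2 + q 2 ^ 2 := by
    rw [hζ, LinearIsometryEquiv.norm_map, norm_sq_eq_coords]
  have e4 : ‖cart (p, x, y)‖ ^ 2 = p ^ 2 + x ^ 2 + y ^ 2 := by rw [norm_sq_eq_coords]; simp
  have hn : 0 < ‖cart (p, x, y)‖ := by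
    refine norm_pos_iff.2 fun h => hp.ne' ?_
    simpa using congrArg (fun v : E3 => v 0) h
  unfold gainWeight
  rw [hi, e1, e2, ha, LinearIsometryEquiv.norm_map]
  refine (mul_le_mul_of_nonneg_right
    (gain_weight_le h0 h1 (norm_nonneg ζ) e3 hn e4 hx hy) hp.le).trans_eq ?_
  ring

@[fun_prop]
theorem measurable_apse {X : Type*} [MeasurableSpace X] {f : X → E3} {g h : X → ℝ}
    (hf : Measurable f) (hg : Measurable g) (hh : Measurable h) :
    Measurable fun x => apse (f x) (g x) (h x) := by
  simp only [apse_eq, sph]; fun_prop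

/-- The gain term, with the angular part of the cross section replaced by `cos θ sin θ`. -/
noncomputable def gainIntegral (γ : ℝ) (h : E3 → ℝ≥0∞) (ζ : E3) : ℝ≥0∞ :=
  ∫⁻ V, ∫⁻ ε in Ioo 0 (2 * π), ∫⁻ θ in Ioo 0 (π / 2), ENNReal.ofReal (sin θ) *
    (ENNReal.ofReal (gainWeight γ ζ V (apse V θ ε)) *
      h (ζ + inner ℝ V (apse V θ ε) • apse V θ ε))

/-- The Gaussian weight of the gain term after integration over the plane orthogonal to the apse
line. -/
noncomputable def rayWeight (ζ z : E3) (p : ℝ) : ℝ :=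
  exp (-(((inner ℝ ζ (‖z‖⁻¹ • z) + p) ^ 2 + inner ℝ ζ (‖z‖⁻¹ • z) ^ 2) / 4))

/-- Reflecting the direction of `z` onto the first axis separates p = V·ω from the orthogonal plane.
The argument of `h` involves p alone, so the plane carries only two line weights, each of integral
at most `D`. -/
theorem lintegral_gainWeight_le {γ : ℝ} (h0 : 0 ≤ γ) (h1 : γ < 1) {D : ℝ≥0∞}
    (hDt : D ≠ ∞) (hD : ∀ b, ∫⁻ w, ENNReal.ofReal (lineWeight b w) ≤ D) (ζ : E3) {z : E3} (hz : z ≠ 0)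
    {h : E3 → ℝ≥0∞} (hh : Measurable h) :
    ∫⁻ V in {V | 0 < inner ℝ V z}, ENNReal.ofReal (gainWeight γ ζ V (‖z‖⁻¹ • z)) *
        h (ζ + inner ℝ V (‖z‖⁻¹ • z) • (‖z‖⁻¹ • z)) ≤
      ENNReal.ofReal (16 * (1 + ‖ζ‖) ^ (γ - 1)) * D ^ 2 * ∫⁻ p in Ioi (0 : ℝ),
        ENNReal.ofReal (p * rayWeight ζ z p) * h (ζ + p • (‖z‖⁻¹ • z)) := by
  have hm : MeasurableSet {V : E3 | 0 < inner ℝ V z} :=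
    measurableSet_lt (by fun_prop) (by fun_prop)
  have hlw : ∀ b, Measurable fun w => ENNReal.ofReal (lineWeight b w) := fun b => by
    unfold lineWeight; fun_prop
  rw [← lintegral_indicator hm, ← lintegral_axisRefl z]
  have e : ∀ x : E3, {V : E3 | 0 < inner ℝ V z}.indicator (fun V =>
      ENNReal.ofReal (gainWeight γ ζ V (‖z‖⁻¹ • z)) *
        h (ζ + inner ℝ V (‖z‖⁻¹ • z) • (‖z‖⁻¹ • z))) (axisRefl z x) =
      {x : E3 | 0 < x 0}.indicator (fun x =>
        ENNReal.ofReal (gainWeight γ ζ (axisRefl z x) (‖z‖⁻¹ • z)) *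
          h (ζ + x 0 • (‖z‖⁻¹ • z))) x := by
    intro x
    have hi := inner_direction_axisRefl hz x
    have hi' : (0 < inner ℝ (axisRefl z x) z) ↔ 0 < x 0 := by
      rw [← hi, inner_smul_right]
      have := norm_pos_iff.2 hz
      constructor
      · intro h; positivity
      · intro h; exact pos_of_mul_pos_right h (by positivity)
    simp only [indicator, mem_ofPred_eq, hi', hi]
  rw [lintegral_congr e, lintegral_cart (Measurable.indicator (by fun_prop)
    (measurableSet_lt (by fun_prop) (by fun_prop)))]
  rw [← lintegral_const_mul' _ _ (by finiteness), ← lintegral_indicator measurableSet_Ioi]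
  refine lintegral_mono fun p => ?_
  by_cases hp : 0 < p
  swap
  · simp [indicator, hp]
  rw [indicator_of_mem (mem_Ioi.2 hp)]
  have h2 : ∀ᵐ x : ℝ, x ≠ 0 := Measure.ae_ne volume 0
  calc _ ≤ ∫⁻ x, ∫⁻ y, ENNReal.ofReal (16 * (1 + ‖ζ‖) ^ (γ - 1)) *
        (ENNReal.ofReal (p * rayWeight ζ z p) * h (ζ + p • (‖z‖⁻¹ • z))) *
        (ENNReal.ofReal (lineWeight (axisRefl z ζ 1) x) *
          ENNReal.ofReal (lineWeight (axisRefl z ζ 2) y)) := by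
        refine lintegral_mono_ae (h2.mono fun x hx => lintegral_mono_ae (h2.mono fun y hy => ?_))
        rw [indicator_of_mem (show cart (p, x, y) ∈ {x : E3 | 0 < x 0} from hp), cart_zero_apply]
        have hr : 0 ≤ p * rayWeight ζ z p := by unfold rayWeight; positivity
        calc _ ≤ ENNReal.ofReal (16 * (1 + ‖ζ‖) ^ (γ - 1) * (p * rayWeight ζ z p) *
              (lineWeight (axisRefl z ζ 1) x * lineWeight (axisRefl z ζ 2) y)) *
              h (ζ + p • (‖z‖⁻¹ • z)) := by
              gcongr
              exact gainWeight_axisRefl_le h0 h1 ζ hz hp hx hy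
          _ = _ := by
              rw [ENNReal.ofReal_mul (by positivity), ENNReal.ofReal_mul (by positivity),
                ENNReal.ofReal_mul (lineWeight_nonneg _ _)]
              ring
    _ = ENNReal.ofReal (16 * (1 + ‖ζ‖) ^ (γ - 1)) *
        (ENNReal.ofReal (p * rayWeight ζ z p) * h (ζ + p • (‖z‖⁻¹ • z))) *
        ((∫⁻ x, ENNReal.ofReal (lineWeight (axisRefl z ζ 1) x)) *
          ∫⁻ y, ENNReal.ofReal (lineWeight (axisRefl z ζ 2) y)) := by
        have : ∀ x, Measurable fun y => ENNReal.ofReal (lineWeight (axisRefl z ζ 1) x) *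
          ENNReal.ofReal (lineWeight (axisRefl z ζ 2) y) := fun x => (hlw _).const_mul _
        simp_rw [lintegral_const_mul _ (this _), lintegral_const_mul _ (hlw _)]
        rw [lintegral_const_mul _ ((hlw _).mul_const _), lintegral_mul_const _ (hlw _)]
    _ ≤ ENNReal.ofReal (16 * (1 + ‖ζ‖) ^ (γ - 1)) *
        (ENNReal.ofReal (p * rayWeight ζ z p) * h (ζ + p • (‖z‖⁻¹ • z))) * (D * D) := by
        gcongr <;> apply hD
    _ = _ := by ring

/-- Here `n` stands for |ζ'|. From 1 + |ζ| ≤ (1+n)(1+p), the decay in ζ' becomes decay in ζ at the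
cost of 1 + p, which the Gaussian in p absorbs. As |z| < 1, the direction of z may be replaced by z
itself, the form that `exists_lintegral_ball_exp_le` handles. -/
theorem rayWeight_sq_mul_le {γ : ℝ} (h0 : 0 ≤ γ) (h1 : γ < 1) (ζ z : E3) {p n : ℝ} (hp : 0 < p)
    (hn : 0 ≤ n) (hs : ‖ζ‖ ≤ n + p) (hz : ‖z‖ < 1) :
    (rayWeight ζ z p * (1 + n) ^ (-(γ / 2))) ^ 2 ≤
      (1 + ‖ζ‖) ^ (-γ) * exp (-(inner ℝ ζ z ^ 2 / 4)) * (5 * exp (-(16⁻¹ * p ^ 2))) := by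
  set a := inner ℝ ζ (‖z‖⁻¹ • z) with ha
  have hza : inner ℝ ζ z ^ 2 ≤ a ^ 2 := by
    rcases eq_or_ne z 0 with rfl | h
    · simp [ha]
    have : inner ℝ ζ z = ‖z‖ * a := by
      rw [ha, inner_smul_right, ← mul_assoc, mul_inv_cancel₀ (norm_ne_zero_iff.2 h), one_mul]
    rw [this, mul_pow]
    exact mul_le_of_le_one_left (sq_nonneg a) (pow_le_one₀ (norm_nonneg z) hz.le)
  have e1 : rayWeight ζ z p ^ 2 ≤ exp (-(inner ℝ ζ z ^ 2 / 4)) * exp (-(8⁻¹ * p ^ 2)) := by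
    unfold rayWeight
    rw [← exp_nat_mul, ← exp_add, ← ha]
    refine exp_le_exp.2 ?_
    push_cast
    nlinarith [sq_nonneg (2 * a + p), sq_nonneg (a + p)]
  have e2 : ((1 + n) ^ (-(γ / 2))) ^ 2 ≤ (1 + ‖ζ‖) ^ (-γ) * (1 + p) := by
    rw [← rpow_natCast, ← rpow_mul (by positivity)]
    rw [show -(γ / 2) * (2 : ℕ) = -γ by push_cast; ring, rpow_neg (by positivity),
      rpow_neg (by positivity : 0 ≤ 1 + ‖ζ‖), inv_mul_eq_div,
      le_div_iff₀ (by positivity), inv_mul_le_iff₀ (by positivity)]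
    calc (1 + ‖ζ‖) ^ γ ≤ ((1 + n) * (1 + p)) ^ γ := by gcongr; nlinarith
      _ = (1 + n) ^ γ * (1 + p) ^ γ := mul_rpow (by positivity) (by positivity)
      _ ≤ (1 + n) ^ γ * (1 + p) ^ (1 : ℝ) := by gcongr; linarith
      _ = _ := by rw [rpow_one]
  have e3 : (1 + p) * exp (-(8⁻¹ * p ^ 2)) ≤ 5 * exp (-(16⁻¹ * p ^ 2)) := by
    have h3 : 1 + p ≤ 5 * exp (16⁻¹ * p ^ 2) := by
      nlinarith [add_one_le_exp (16⁻¹ * p ^ 2), sq_nonneg (p - 2)]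
    have h4 : exp (-(16⁻¹ * p ^ 2)) = exp (16⁻¹ * p ^ 2) * exp (-(8⁻¹ * p ^ 2)) := by
      rw [← exp_add]; ring_nf
    rw [h4, ← mul_assoc]
    gcongr
  calc _ = rayWeight ζ z p ^ 2 * ((1 + n) ^ (-(γ / 2))) ^ 2 := mul_pow _ _ _
    _ ≤ (exp (-(inner ℝ ζ z ^ 2 / 4)) * exp (-(8⁻¹ * p ^ 2))) * ((1 + ‖ζ‖) ^ (-γ) * (1 + p)) := by
        gcongr
    _ = (1 + ‖ζ‖) ^ (-γ) * exp (-(inner ℝ ζ z ^ 2 / 4)) * ((1 + p) * exp (-(8⁻¹ * p ^ 2))) := by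
        ring
    _ ≤ _ := by gcongr

@[fun_prop]
theorem measurable_rayWeight {X : Type*} [MeasurableSpace X] {f g : X → E3} {h : X → ℝ}
    (hf : Measurable f) (hg : Measurable g) (hh : Measurable h) :
    Measurable fun x => rayWeight (f x) (g x) (h x) := by
  unfold rayWeight; fun_prop

/-- Cauchy–Schwarz with the factor p placed beside `h`: its square p² is the polar Jacobian around
ζ, so `h` is measured in Lebesgue measure. The power γ/2 of 1 + |ζ'| moved between the factors
produces the weight of L*. -/
theorem sq_lintegral_ray_le {γ : ℝ} (h0 : 0 ≤ γ) (h1 : γ < 1) {D : ℝ≥0∞}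
    (hD : ∀ ζ : E3, ∫⁻ z in Metric.ball (0 : E3) 1,
      ENNReal.ofReal (exp (-(inner ℝ ζ z ^ 2 / 4))) ≤ D * ENNReal.ofReal ((1 + ‖ζ‖)⁻¹))
    (ζ : E3) {h : E3 → ℝ≥0∞} (hh : Measurable h) :
    (∫⁻ z in Metric.ball (0 : E3) 1, ∫⁻ p in Ioi (0 : ℝ),
      ENNReal.ofReal (p * rayWeight ζ z p) * h (ζ + p • (‖z‖⁻¹ • z))) ^ 2 ≤
    3⁻¹ * (5 * ENNReal.ofReal (√(π / 16⁻¹))) * D * ENNReal.ofReal ((1 + ‖ζ‖) ^ (-γ - 1)) *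
      ∫⁻ v, h v ^ 2 * ENNReal.ofReal ((1 + ‖v‖) ^ γ) := by
  set μ := (volume.restrict (Metric.ball (0 : E3) 1)).prod (volume.restrict (Ioi (0 : ℝ)))
  set f : E3 × ℝ → ℝ≥0∞ := fun q => ENNReal.ofReal q.2 * h (ζ + q.2 • (‖q.1‖⁻¹ • q.1)) *
    ENNReal.ofReal ((1 + ‖ζ + q.2 • (‖q.1‖⁻¹ • q.1)‖) ^ (γ / 2)) with hf
  set g : E3 × ℝ → ℝ≥0∞ := fun q => ENNReal.ofReal (rayWeight ζ q.1 q.2 *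
    (1 + ‖ζ + q.2 • (‖q.1‖⁻¹ • q.1)‖) ^ (-(γ / 2))) with hg
  have hfm : Measurable f := by fun_prop
  have hgm : Measurable g := by fun_prop
  have e : ∫⁻ z in Metric.ball (0 : E3) 1, ∫⁻ p in Ioi (0 : ℝ),
      ENNReal.ofReal (p * rayWeight ζ z p) * h (ζ + p • (‖z‖⁻¹ • z)) = ∫⁻ q, f q * g q ∂μ := by
    rw [lintegral_prod _ (by fun_prop)]
    refine lintegral_congr fun z => setLIntegral_congr_fun measurableSet_Ioi fun p (hp : 0 < p) => ?_
    simp only [hf, hg]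
    set n := 1 + ‖ζ + p • (‖z‖⁻¹ • z)‖
    have hn : 0 < n := by positivity
    have hr : 0 ≤ rayWeight ζ z p := (exp_pos _).le
    have h2 : ENNReal.ofReal (n ^ (γ / 2)) * ENNReal.ofReal (n ^ (-(γ / 2))) = 1 := by
      rw [← ENNReal.ofReal_mul (by positivity), ← rpow_add hn]; simp
    rw [ENNReal.ofReal_mul hp.le, ENNReal.ofReal_mul hr]
    calc _ = ENNReal.ofReal p * ENNReal.ofReal (rayWeight ζ z p) * h (ζ + p • (‖z‖⁻¹ • z)) * 1 := by
          ring
      _ = _ := by rw [← h2]; ring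
  have ef : ∫⁻ q, f q ^ 2 ∂μ = 3⁻¹ * ∫⁻ v, h v ^ 2 * ENNReal.ofReal ((1 + ‖v‖) ^ γ) := by
    rw [lintegral_prod _ (by fun_prop), ← lintegral_add_left_eq_self (μ := volume)
        (fun v : E3 => h v ^ 2 * ENNReal.ofReal ((1 + ‖v‖) ^ γ)) ζ,
      ← lintegral_ball_lintegral_direction (by fun_prop)]
    refine lintegral_congr fun z => setLIntegral_congr_fun measurableSet_Ioi fun p (hp : 0 < p) => ?_
    simp only [hf]
    rw [mul_pow, mul_pow, ← ENNReal.ofReal_pow hp.le, ← ENNReal.ofReal_pow (by positivity),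
      ← rpow_natCast _ 2, ← rpow_natCast (_ ^ _) 2, ← rpow_mul (by positivity), ← mul_assoc]
    simp
  have eg : ∫⁻ q, g q ^ 2 ∂μ ≤ ENNReal.ofReal ((1 + ‖ζ‖) ^ (-γ)) *
      (D * ENNReal.ofReal ((1 + ‖ζ‖)⁻¹) * (5 * ENNReal.ofReal (√(π / 16⁻¹)))) := by
    calc _ ≤ ∫⁻ z in Metric.ball (0 : E3) 1, ∫⁻ p in Ioi (0 : ℝ),
          ENNReal.ofReal ((1 + ‖ζ‖) ^ (-γ)) * (ENNReal.ofReal (exp (-(inner ℝ ζ z ^ 2 / 4))) *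
            (5 * ENNReal.ofReal (exp (-(16⁻¹ * p ^ 2))))) := by
          rw [lintegral_prod _ (by fun_prop)]
          refine setLIntegral_mono' measurableSet_ball fun z hz =>
            setLIntegral_mono' measurableSet_Ioi fun p (hp : 0 < p) => ?_
          have hzn : ‖z‖ < 1 := by simpa using hz
          have hu : ‖ζ‖ ≤ ‖ζ + p • (‖z‖⁻¹ • z)‖ + p := by
            have h3 : ‖p • (‖z‖⁻¹ • z)‖ ≤ p := by
              rw [norm_smul, norm_smul, norm_inv, norm_norm, norm_of_nonneg hp.le]
              exact mul_le_of_le_one_right hp.le (inv_mul_le_one)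
            have h4 := norm_sub_le (ζ + p • (‖z‖⁻¹ • z)) (p • (‖z‖⁻¹ • z))
            rw [add_sub_cancel_right] at h4
            linarith
          rw [← ENNReal.ofReal_ofNat 5, ← ENNReal.ofReal_mul (by norm_num),
            ← ENNReal.ofReal_mul (exp_pos _).le, ← ENNReal.ofReal_mul (by positivity),
            ← mul_assoc, ← ENNReal.ofReal_pow (by unfold rayWeight; positivity)]
          exact ENNReal.ofReal_le_ofReal
            (rayWeight_sq_mul_le h0 h1 ζ z hp (norm_nonneg _) hu hzn)
      _ = ENNReal.ofReal ((1 + ‖ζ‖) ^ (-γ)) * ((∫⁻ z in Metric.ball (0 : E3) 1,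
          ENNReal.ofReal (exp (-(inner ℝ ζ z ^ 2 / 4)))) *
            ∫⁻ p in Ioi (0 : ℝ), 5 * ENNReal.ofReal (exp (-(16⁻¹ * p ^ 2)))) := by
          rw [← lintegral_mul_const _ (by fun_prop), ← lintegral_const_mul _ (by fun_prop)]
          refine lintegral_congr fun z => ?_
          rw [lintegral_const_mul _ (by fun_prop), lintegral_const_mul _ (by fun_prop)]
      _ ≤ _ := by
          gcongr
          · exact hD ζ
          · rw [← lintegral_gaussian (by norm_num), ← lintegral_const_mul _ (by fun_prop)]
            exact setLIntegral_le_lintegral _ _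
  rw [e]
  refine (sq_lintegral_mul_le hfm.aemeasurable hgm.aemeasurable).trans ?_
  rw [ef]
  refine (mul_le_mul_right eg _).trans_eq ?_
  rw [show -γ - 1 = -γ + -1 by ring, rpow_add (by positivity), rpow_neg_one,
    ENNReal.ofReal_mul (by positivity)]
  ring

theorem exists_gainIntegral_sq_le {γ : ℝ} (h0 : 0 ≤ γ) (h1 : γ < 1) :
    ∃ C : ℝ≥0∞, C ≠ ∞ ∧ ∀ (ζ : E3) (h : E3 → ℝ≥0∞), Measurable h →
      gainIntegral γ h ζ ^ 2 ≤ C * ENNReal.ofReal ((1 + ‖ζ‖) ^ (-2 : ℝ)) *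
        ∫⁻ v, h v ^ 2 * ENNReal.ofReal ((1 + ‖v‖) ^ γ) := by
  obtain ⟨D, hDt, hD⟩ := exists_lintegral_lineWeight_le
  obtain ⟨E, hEt, hE⟩ := exists_lintegral_ball_exp_le
  refine ⟨9 * (256 * D ^ 4) * (3⁻¹ * (5 * ENNReal.ofReal (√(π / 16⁻¹))) * E), ?_,
    fun ζ h hh => ?_⟩
  · have : (3 : ℝ≥0∞)⁻¹ ≠ ∞ := by simp
    finiteness
  have hV : ∀ᵐ V : E3, V ≠ 0 := Measure.ae_ne volume 0
  set Φ : E3 → E3 → ℝ≥0∞ := fun V ω => ENNReal.ofReal (gainWeight γ ζ V ω) *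
    h (ζ + inner ℝ V ω • ω) with hΦ
  have hms : ∀ V : E3, MeasurableSet {z : E3 | 0 < inner ℝ V z} := fun V =>
    measurableSet_lt (by fun_prop) (by fun_prop)
  have step : gainIntegral γ h ζ ≤ 3 * (ENNReal.ofReal (16 * (1 + ‖ζ‖) ^ (γ - 1)) * D ^ 2 *
      ∫⁻ z in Metric.ball (0 : E3) 1, ∫⁻ p in Ioi (0 : ℝ),
        ENNReal.ofReal (p * rayWeight ζ z p) * h (ζ + p • (‖z‖⁻¹ • z))) := by
    calc gainIntegral γ h ζ ≤ ∫⁻ V, 3 * ∫⁻ z in Metric.ball (0 : E3) 1,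
          {q : E3 × E3 | 0 < inner ℝ q.1 q.2}.indicator
            (fun q => Φ q.1 (‖q.2‖⁻¹ • q.2)) (V, z) := by
          refine lintegral_mono_ae (hV.mono fun V hV => ?_)
          refine (lintegral_apse_le (F := Φ V) (by fun_prop) hV).trans_eq ?_
          rw [inter_comm, ← Measure.restrict_restrict (hms V), ← lintegral_indicator (hms V)]
          rfl
      _ = 3 * ∫⁻ z in Metric.ball (0 : E3) 1, ∫⁻ V,
          {q : E3 × E3 | 0 < inner ℝ q.1 q.2}.indicator
            (fun q => Φ q.1 (‖q.2‖⁻¹ • q.2)) (V, z) := by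
          rw [lintegral_const_mul' _ _ (by simp), lintegral_lintegral_swap]
          refine (Measurable.indicator ?_ (measurableSet_lt (by fun_prop) (by fun_prop))).aemeasurable
          fun_prop
      _ ≤ 3 * ∫⁻ z in Metric.ball (0 : E3) 1, ENNReal.ofReal (16 * (1 + ‖ζ‖) ^ (γ - 1)) * D ^ 2 *
          ∫⁻ p in Ioi (0 : ℝ), ENNReal.ofReal (p * rayWeight ζ z p) *
            h (ζ + p • (‖z‖⁻¹ • z)) := by
          refine mul_le_mul_right (lintegral_mono_ae (ae_restrict_of_ae (hV.mono fun z hz => ?_))) _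
          refine le_trans (le_of_eq ?_) (lintegral_gainWeight_le h0 h1 hDt hD ζ hz hh)
          rw [← lintegral_indicator (measurableSet_lt (by fun_prop) (by fun_prop))]
          rfl
      _ = _ := by rw [lintegral_const_mul' _ _ (by finiteness)]
  refine (pow_le_pow_left' step 2).trans ?_
  rw [mul_pow, mul_pow]
  refine (mul_le_mul_right (mul_le_mul_right (sq_lintegral_ray_le h0 h1 hE ζ hh) _) _).trans ?_
  -- The exponents add to 2(γ-1) + (-γ-1) = γ - 3, and γ ≤ 1.
  have hpow : ENNReal.ofReal ((1 + ‖ζ‖) ^ (γ - 1)) ^ 2 * ENNReal.ofReal ((1 + ‖ζ‖) ^ (-γ - 1)) ≤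
      ENNReal.ofReal ((1 + ‖ζ‖) ^ (-2 : ℝ)) := by
    rw [← ENNReal.ofReal_pow (by positivity), ← ENNReal.ofReal_mul (by positivity),
      ← rpow_natCast, ← rpow_mul (by positivity), ← rpow_add (by positivity)]
    refine ENNReal.ofReal_le_ofReal (rpow_le_rpow_of_exponent_le ?_ ?_)
    · linarith [norm_nonneg ζ]
    · push_cast; linarith
  rw [ENNReal.ofReal_mul (by norm_num), ENNReal.ofReal_ofNat]
  calc _ = 9 * (256 * D ^ 4) * (3⁻¹ * (5 * ENNReal.ofReal (√(π / 16⁻¹))) * E) *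
        (ENNReal.ofReal ((1 + ‖ζ‖) ^ (γ - 1)) ^ 2 * ENNReal.ofReal ((1 + ‖ζ‖) ^ (-γ - 1))) *
        ∫⁻ v, h v ^ 2 * ENNReal.ofReal ((1 + ‖v‖) ^ γ) := by ring
    _ ≤ _ := by gcongr

/-! ### Bounds for the integral operator -/

theorem collisionMeasure_eq : collisionMeasure = (volume : Measure E3).prod
    ((volume.restrict (Ioo (0 : ℝ) (2 * π))).prod (volume.restrict (Ioo (0 : ℝ) (π / 2)))) := by
  unfold collisionMeasure
  rw [Measure.volume_eq_prod, ← Measure.prod_restrict, Measure.restrict_univ,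
    Measure.volume_eq_prod, ← Measure.prod_restrict]

theorem lintegral_collisionMeasure {F : E3 × ℝ × ℝ → ℝ≥0∞} (hF : Measurable F) :
    ∫⁻ p, F p ∂collisionMeasure = ∫⁻ η, ∫⁻ ε in Ioo 0 (2 * π), ∫⁻ θ in Ioo 0 (π / 2),
      F (η, ε, θ) := by
  rw [collisionMeasure_eq, lintegral_prod _ (by fun_prop)]
  refine lintegral_congr fun η => ?_
  rw [lintegral_prod _ (by fun_prop)]

theorem ae_collisionMeasure_of_ae {P : E3 → Prop} (h : ∀ᵐ η : E3, P η) :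
    ∀ᵐ p ∂collisionMeasure, P p.1 := by
  rw [collisionMeasure_eq]
  exact Measure.quasiMeasurePreserving_fst.ae h

theorem ae_collisionMeasure_mem :
    ∀ᵐ p : E3 × ℝ × ℝ ∂collisionMeasure, p.2.1 ∈ Ioo 0 (2 * π) ∧ p.2.2 ∈ Ioo 0 (π / 2) := by
  unfold collisionMeasure
  filter_upwards [ae_restrict_mem (MeasurableSet.univ.prod
    (measurableSet_Ioo.prod measurableSet_Ioo))] with p hp
  exact hp.2

/-- The integrand of `gainIntegral`. -/
noncomputable def gainDensity (γ : ℝ) (h : E3 → ℝ≥0∞) (ζ V : E3) (θ ε : ℝ) : ℝ≥0∞ :=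
  ENNReal.ofReal (sin θ) * (ENNReal.ofReal (gainWeight γ ζ V (apse V θ ε)) *
      h (ζ + inner ℝ V (apse V θ ε) • apse V θ ε))

theorem measurable_gainDensity (γ : ℝ) {h : E3 → ℝ≥0∞} (hh : Measurable h) {X : Type*}
    [MeasurableSpace X] {a b : X → E3} {c d : X → ℝ}
    (ha : Measurable a) (hb : Measurable b) (hc : Measurable c) (hd : Measurable d) :
    Measurable fun x => gainDensity γ h (a x) (b x) (c x) (d x) := by
  unfold gainDensity; fun_prop

theorem lintegral_gainDensity (γ : ℝ) {h : E3 → ℝ≥0∞} (hh : Measurable h) (ζ : E3) :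
    ∫⁻ p, gainDensity γ h ζ (p.1 - ζ) p.2.2 p.2.1 ∂collisionMeasure = gainIntegral γ h ζ := by
  rw [lintegral_collisionMeasure (measurable_gainDensity γ hh (by fun_prop) (by fun_prop)
    (by fun_prop) (by fun_prop))]
  exact lintegral_sub_right_eq_self (μ := volume) (fun V => ∫⁻ ε in Ioo 0 (2 * π),
    ∫⁻ θ in Ioo 0 (π / 2), gainDensity γ h ζ V θ ε) ζ

/-- The angular substitution preserves dθ dε by reflection in θ and periodicity in ε. The term
containing f(ζ_*') therefore needs no separate estimate. -/
theorem lintegral_gainDensity_swap (γ : ℝ) {h : E3 → ℝ≥0∞} (hh : Measurable h) (ζ : E3) :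
    ∫⁻ p, gainDensity γ h ζ (p.1 - ζ) (π / 2 - p.2.2) (p.2.1 + π) ∂collisionMeasure =
      gainIntegral γ h ζ := by
  rw [← lintegral_gainDensity γ hh ζ, lintegral_collisionMeasure (measurable_gainDensity γ hh
    (by fun_prop) (by fun_prop) (by fun_prop) (by fun_prop)),
    lintegral_collisionMeasure (measurable_gainDensity γ hh
    (by fun_prop) (by fun_prop) (by fun_prop) (by fun_prop))]
  refine lintegral_congr fun η => ?_
  simp only
  have hθ : ∀ ε, ∫⁻ θ in Ioo 0 (π / 2), gainDensity γ h ζ (η - ζ) (π / 2 - θ) ε =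
      ∫⁻ θ in Ioo 0 (π / 2), gainDensity γ h ζ (η - ζ) θ ε := fun ε => by
    have := (Measure.measurePreserving_sub_left volume (π / 2)).setLIntegral_comp_preimage
      (measurableSet_Ioo (a := 0) (b := π / 2)) (f := fun θ => gainDensity γ h ζ (η - ζ) θ ε)
      (measurable_gainDensity γ hh (by fun_prop) (by fun_prop) (by fun_prop) (by fun_prop))
    simpa using this
  simp_rw [hθ]
  set H : ℝ → ℝ≥0∞ := fun ε => ∫⁻ θ in Ioo 0 (π / 2), gainDensity γ h ζ (η - ζ) θ ε with hH
  have hHm : Measurable H := by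
    refine Measurable.lintegral_prod_right' (f := fun q : ℝ × ℝ =>
      gainDensity γ h ζ (η - ζ) q.2 q.1) ?_
    exact measurable_gainDensity γ hh (by fun_prop) (by fun_prop) (by fun_prop) (by fun_prop)
  have hper : Function.Periodic H (2 * π) := fun ε => by
    simp only [hH, gainDensity, apse_eq, sph, cos_add_two_pi, sin_add_two_pi]
  have h1 := (measurePreserving_add_right volume π).setLIntegral_comp_preimage
      (measurableSet_Ioo (a := π) (b := π + 2 * π)) hHm
  have h2 := setLIntegral_Ioo_of_periodic two_pi_pos hper π 0
  rw [zero_add] at h2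
  rw [← h2, ← h1]
  simp
  rfl

/-! ### Collision geometry: exchanging the outgoing velocities -/

/-- The two apse vectors are orthonormal in a plane containing `V`, so `V` is the sum of its
projections onto them. -/
theorem inner_smul_apse_add (V : E3) (θ ε : ℝ) :
    inner ℝ V (apse V θ ε) • apse V θ ε +
      inner ℝ V (apse V (π / 2 - θ) (ε + π)) • apse V (π / 2 - θ) (ε + π) = V := by
  rcases eq_or_ne V 0 with rfl | hV
  · simp
  have h : cos θ • sph θ ε + sin θ • sph (π / 2 - θ) (ε + π) = axis := by
    ext i
    fin_cases i
    · simp [sph, axis, cos_pi_div_two_sub]; nlinarith [sin_sq_add_cos_sq θ]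
    · simp [sph, axis, sin_pi_div_two_sub]; ring
    · simp [sph, axis, sin_pi_div_two_sub]; ring
  rw [inner_apse, inner_apse, cos_pi_div_two_sub, apse_eq, apse_eq, mul_smul, mul_smul,
    ← smul_add, ← map_smul, ← map_smul, ← map_add, h, axisRefl_axis hV, smul_smul,
    mul_inv_cancel₀ (norm_ne_zero_iff.2 hV), one_smul]

theorem postVel_eq (ζ η : E3) (θ ε : ℝ) : postVel ζ η θ ε =
    ζ + inner ℝ (η - ζ) (apse (η - ζ) θ ε) • apse (η - ζ) θ ε := rfl

theorem postVelStar_eq (ζ η : E3) (θ ε : ℝ) : postVelStar ζ η θ ε =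
    ζ + (η - ζ) - inner ℝ (η - ζ) (apse (η - ζ) θ ε) • apse (η - ζ) θ ε := by
  rw [add_sub_cancel]; rfl

theorem postVelStar_eq_postVel (ζ η : E3) (θ ε : ℝ) :
    postVelStar ζ η θ ε = postVel ζ η (π / 2 - θ) (ε + π) := by
  have := inner_smul_apse_add (η - ζ) θ ε
  rw [postVelStar_eq, postVel_eq, add_sub_assoc]
  congr 1
  exact sub_eq_of_eq_add' this.symm

theorem postVel_eq_postVelStar (ζ η : E3) (θ ε : ℝ) :
    postVel ζ η θ ε = postVelStar ζ η (π / 2 - θ) (ε + π) := by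
  have := inner_smul_apse_add (η - ζ) θ ε
  rw [postVelStar_eq, postVel_eq, add_sub_assoc]
  congr 1
  exact eq_sub_of_add_eq this

/-- Conservation of energy. -/
theorem norm_sq_postVel_add (ζ η : E3) (θ ε : ℝ) :
    ‖postVel ζ η θ ε‖ ^ 2 + ‖postVelStar ζ η θ ε‖ ^ 2 = ‖ζ‖ ^ 2 + ‖η‖ ^ 2 := by
  have ha := norm_apse (η - ζ) θ ε
  rw [postVel, postVelStar, norm_add_sq_real, norm_sub_sq_real, norm_smul, ha, mul_one,
    inner_smul_right, inner_smul_right]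
  set ω := apse (η - ζ) θ ε
  have : inner ℝ (η - ζ) ω = inner ℝ η ω - inner ℝ ζ ω := inner_sub_left _ _ _
  rw [this, norm_eq_abs, sq_abs]
  ring

/-- The factor V·ω = |V| cos θ restores |V|^γ from |V|^(γ-1) and supplies the cosine in the bound
for β. At V = 0 with γ = 0 the powers would disagree, since `0 ^ 0 = 1`; hence `hne`. -/
theorem gainDensity_eq {γ : ℝ} (h : E3 → ℝ≥0∞) {ζ η : E3} (hne : η ≠ ζ) {θ : ℝ}
    (hθ : θ ∈ Ioo 0 (π / 2)) (ε : ℝ) : gainDensity γ h ζ (η - ζ) θ ε =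
      ENNReal.ofReal (exp (-((‖η‖ ^ 2 + ‖postVelStar ζ η θ ε‖ ^ 2) / 2)) * ‖η - ζ‖ ^ γ *
        (cos θ * sin θ)) * h (postVel ζ η θ ε) := by
  have hn : 0 < ‖η - ζ‖ := norm_pos_iff.2 (sub_ne_zero.2 hne)
  have hs : 0 ≤ sin θ := sin_nonneg_of_nonneg_of_le_pi hθ.1.le (by linarith [hθ.2, pi_pos])
  unfold gainDensity gainWeight
  rw [← mul_assoc, ← ENNReal.ofReal_mul hs, ← postVel_eq, ← postVelStar_eq, add_sub_cancel,
    inner_apse, show ‖η - ζ‖ ^ γ = ‖η - ζ‖ ^ (γ - 1) * ‖η - ζ‖ by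
      rw [← rpow_add_one hn.ne', sub_add_cancel]]
  ring_nf

theorem gainDensity_swap_eq {γ : ℝ} (h : E3 → ℝ≥0∞) {ζ η : E3} (hne : η ≠ ζ) {θ : ℝ}
    (hθ : θ ∈ Ioo 0 (π / 2)) (ε : ℝ) : gainDensity γ h ζ (η - ζ) (π / 2 - θ) (ε + π) =
      ENNReal.ofReal (exp (-((‖η‖ ^ 2 + ‖postVel ζ η θ ε‖ ^ 2) / 2)) * ‖η - ζ‖ ^ γ *
        (cos θ * sin θ)) * h (postVelStar ζ η θ ε) := by
  rw [gainDensity_eq h hne ⟨by linarith [hθ.2], by linarith [hθ.1]⟩, ← postVel_eq_postVelStar,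
    ← postVelStar_eq_postVel, cos_pi_div_two_sub, sin_pi_div_two_sub, mul_comm (sin θ)]

/-- The maps `(ζ_*, ε, θ) ↦ ζ'` and `(ζ_*, ε, θ) ↦ ζ_*'` are nonsingular. -/
theorem ae_postVel_of_ae (ζ : E3) {P : E3 → Prop} (hP : ∀ᵐ v : E3, P v) :
    ∀ᵐ p ∂collisionMeasure,
      P (postVel ζ p.1 p.2.2 p.2.1) ∧ P (postVelStar ζ p.1 p.2.2 p.2.1) := by
  set N := toMeasurable volume {v : E3 | ¬ P v} with hN
  have hN0 : volume N = 0 := by rw [hN, measure_toMeasurable]; exact hP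
  have hNm : MeasurableSet N := measurableSet_toMeasurable _ _
  set h : E3 → ℝ≥0∞ := N.indicator 1 with hh
  have hhm : Measurable h := measurable_one.indicator hNm
  have hP' : ∀ v, h v = 0 → P v := fun v hv => by
    by_contra hc
    have : v ∈ N := subset_toMeasurable _ _ hc
    simp [hh, indicator_of_mem this] at hv
  -- For the indicator of a null set the gain estimate gives a zero integral. The collision weights
  -- are strictly positive almost everywhere, so the indicator vanishes at both outgoing velocities.
  -- The exponent γ = 0 suffices.
  obtain ⟨C, hC, hle⟩ := exists_gainIntegral_sq_le le_rfl zero_lt_one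
  have h0 : gainIntegral 0 h ζ = 0 := by
    have : ∫⁻ v, h v ^ 2 * ENNReal.ofReal ((1 + ‖v‖) ^ (0 : ℝ)) = 0 := by
      refine (lintegral_congr_ae ?_).trans lintegral_zero
      have : ∀ᵐ v, v ∉ N := measure_eq_zero_iff_ae_notMem.1 hN0
      filter_upwards [this] with v hv
      simp [hh, indicator_of_notMem hv]
    have h1 := hle ζ h hhm
    rw [this, mul_zero] at h1
    simpa using h1
  have h1 := (lintegral_gainDensity 0 hhm ζ).trans h0
  have h2 := (lintegral_gainDensity_swap 0 hhm ζ).trans h0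
  rw [lintegral_eq_zero_iff (measurable_gainDensity 0 hhm (by fun_prop) (by fun_prop)
    (by fun_prop) (by fun_prop))] at h1 h2
  filter_upwards [h1, h2, ae_collisionMeasure_mem,
    ae_collisionMeasure_of_ae (Measure.ae_ne volume ζ)] with p hp1 hp2 hp hne
  have hs : 0 < sin p.2.2 := sin_pos_of_pos_of_lt_pi hp.2.1 (by linarith [hp.2.2, pi_pos])
  have hc : 0 < cos p.2.2 := cos_pos_of_mem_Ioo ⟨by linarith [hp.2.1, pi_pos], hp.2.2⟩
  rw [gainDensity_eq h hne hp.2, Pi.zero_apply, mul_eq_zero, ENNReal.ofReal_eq_zero] at hp1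
  rw [gainDensity_swap_eq h hne hp.2, Pi.zero_apply, mul_eq_zero, ENNReal.ofReal_eq_zero] at hp2
  exact ⟨hP' _ (hp1.resolve_left (not_le.2 (by simp only [rpow_zero]; positivity))),
    hP' _ (hp2.resolve_left (not_le.2 (by simp only [rpow_zero]; positivity)))⟩

theorem nonlocalIntegrand_ae_congr (γ : ℝ) (β : ℝ → ℝ) {f g : E3 → ℝ} (hfg : f =ᵐ[volume] g)
    (ζ : E3) : nonlocalIntegrand γ β f ζ =ᵐ[collisionMeasure] nonlocalIntegrand γ β g ζ := by
  filter_upwards [ae_postVel_of_ae ζ hfg, ae_collisionMeasure_of_ae hfg] with p hp hp'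
  simp only [nonlocalIntegrand, perturb, hp.1, hp.2, hp']

theorem integralOp_congr (γ : ℝ) (β : ℝ → ℝ) {f g : E3 → ℝ} (hfg : f =ᵐ[volume] g)
    (ζ : E3) : integralOp γ β f ζ = integralOp γ β g ζ := by
  unfold integralOp
  rw [integral_congr_ae (nonlocalIntegrand_ae_congr γ β hfg ζ)]

theorem sqrt_maxwellian (ζ : E3) :
    √(maxwellian ζ) = √(π ^ (-(3 / 2) : ℝ)) * exp (-(‖ζ‖ ^ 2 / 2)) := by
  unfold maxwellian
  rw [sqrt_mul (by positivity), ← exp_half]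
  ring_nf

theorem sqrt_maxwellian_pos (ζ : E3) : 0 < √(maxwellian ζ) := by
  unfold maxwellian; positivity

/-- Half of the total energy on the left equals half of the energy on the right; what is left of the
exponent is |a|²/2. With c = ζ this isolates the factor √M(ζ) that K divides out. -/
theorem maxwellian_mul_sqrt_le {a b c d : E3} (h : ‖a‖ ^ 2 + ‖b‖ ^ 2 = ‖c‖ ^ 2 + ‖d‖ ^ 2) :
    maxwellian a * √(maxwellian b) ≤
      √(maxwellian c) * exp (-((‖d‖ ^ 2 + ‖a‖ ^ 2) / 2)) := by
  have hm : π ^ (-(3 / 2) : ℝ) ≤ 1 :=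
    rpow_le_one_of_one_le_of_nonpos (by linarith [pi_gt_three]) (by norm_num)
  rw [sqrt_maxwellian, sqrt_maxwellian, maxwellian]
  have e : exp (-‖a‖ ^ 2) * exp (-(‖b‖ ^ 2 / 2)) =
      exp (-(‖c‖ ^ 2 / 2)) * exp (-((‖d‖ ^ 2 + ‖a‖ ^ 2) / 2)) := by
    rw [← exp_add, ← exp_add]; congr 1; linarith
  calc _ = π ^ (-(3 / 2) : ℝ) * (√(π ^ (-(3 / 2) : ℝ)) *
        (exp (-‖a‖ ^ 2) * exp (-(‖b‖ ^ 2 / 2)))) := by ring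
    _ ≤ 1 * (√(π ^ (-(3 / 2) : ℝ)) * (exp (-‖a‖ ^ 2) * exp (-(‖b‖ ^ 2 / 2)))) := by gcongr
    _ = _ := by rw [e]; ring

@[fun_prop]
theorem measurable_maxwellian : Measurable maxwellian := by unfold maxwellian; fun_prop

@[fun_prop]
theorem measurable_postVel {X : Type*} [MeasurableSpace X] {a b : X → E3} {c d : X → ℝ}
    (ha : Measurable a) (hb : Measurable b) (hc : Measurable c) (hd : Measurable d) :
    Measurable fun x => postVel (a x) (b x) (c x) (d x) := by
  unfold postVel; fun_prop

@[fun_prop]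
theorem measurable_postVelStar {X : Type*} [MeasurableSpace X] {a b : X → E3} {c d : X → ℝ}
    (ha : Measurable a) (hb : Measurable b) (hc : Measurable c) (hd : Measurable d) :
    Measurable fun x => postVelStar (a x) (b x) (c x) (d x) := by
  unfold postVelStar; fun_prop

theorem measurable_nonlocalIntegrand (γ : ℝ) {β : ℝ → ℝ} (hβ : Measurable β) {X : Type*}
    [MeasurableSpace X] {f : X → E3 → ℝ} (hf : Measurable fun q : X × E3 => f q.1 q.2)
    {a : X → E3} (ha : Measurable a) :
    Measurable fun q : X × E3 × ℝ × ℝ => nonlocalIntegrand γ β (f q.1) (a q.1) q.2 := by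
  have hf' : ∀ {b : X × E3 × ℝ × ℝ → E3}, Measurable b →
      Measurable fun q : X × E3 × ℝ × ℝ => f q.1 (b q) := fun hb =>
    hf.comp (measurable_fst.prodMk hb)
  have hp : ∀ {b : X × E3 × ℝ × ℝ → E3}, Measurable b →
      Measurable fun q : X × E3 × ℝ × ℝ => perturb (f q.1) (b q) := fun hb => by
    have := hf' hb
    unfold perturb; fun_prop
  have h1 := hp (b := fun q => postVel (a q.1) q.2.1 q.2.2.2 q.2.2.1) (by fun_prop)
  have h2 := hp (b := fun q => postVelStar (a q.1) q.2.1 q.2.2.2 q.2.2.1) (by fun_prop)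
  have h3 := hp (b := fun q => q.2.1) (by fun_prop)
  unfold nonlocalIntegrand crossSection
  fun_prop

/-- The majorant of the loss term. -/
noncomputable def lossDensity (h : E3 → ℝ≥0∞) (η : E3) : ℝ≥0∞ :=
  ENNReal.ofReal (exp (-(‖η‖ ^ 2 / 4))) * h η

theorem enorm_nonlocalIntegrand_le {γ : ℝ} (h0 : 0 ≤ γ) (h1 : γ < 1) {β : ℝ → ℝ} {C : ℝ}
    (hC : 0 ≤ C) (hβ : ∀ θ ∈ Ioo (0 : ℝ) (π / 2), 0 ≤ β θ ∧ β θ ≤ C * (cos θ * sin θ))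
    (f : E3 → ℝ) {ζ : E3} {p : E3 × ℝ × ℝ} (hne : p.1 ≠ ζ) (hp : p.2.2 ∈ Ioo 0 (π / 2)) :
    ‖nonlocalIntegrand γ β f ζ p‖ₑ ≤ ENNReal.ofReal (√(maxwellian ζ) * C) *
      (gainDensity γ (fun v => ‖f v‖ₑ) ζ (p.1 - ζ) (π / 2 - p.2.2) (p.2.1 + π) +
        gainDensity γ (fun v => ‖f v‖ₑ) ζ (p.1 - ζ) p.2.2 p.2.1 +
        ENNReal.ofReal (8 * (1 + ‖ζ‖)⁻¹) * lossDensity (fun v => ‖f v‖ₑ) p.1) := by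
  obtain ⟨η, ε, θ⟩ := p
  simp only at hne hp ⊢
  rw [gainDensity_eq _ hne hp, gainDensity_swap_eq _ hne hp]
  have hs : 0 < sin θ := sin_pos_of_pos_of_lt_pi hp.1 (by linarith [hp.2, pi_pos])
  have hc : 0 < cos θ := cos_pos_of_mem_Ioo ⟨by linarith [hp.1, pi_pos], hp.2⟩
  have hcs : cos θ * sin θ ≤ 1 := mul_le_one₀ (cos_le_one θ) hs.le (sin_le_one θ)
  obtain ⟨hb0, hb⟩ := hβ θ hp
  have henergy := norm_sq_postVel_add ζ η θ ε
  set v' := postVel ζ η θ ε with hv'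
  set w' := postVelStar ζ η θ ε with hw'
  set B := crossSection γ β ‖η - ζ‖ θ with hB
  have hB0 : 0 ≤ B := mul_nonneg (by positivity) hb0
  have hB1 : B ≤ C * (‖η - ζ‖ ^ γ * (cos θ * sin θ)) := by
    rw [hB, crossSection]
    calc _ ≤ ‖η - ζ‖ ^ γ * (C * (cos θ * sin θ)) := by gcongr
      _ = _ := by ring
  set m := √(maxwellian ζ) with hm
  have hm0 : 0 < m := sqrt_maxwellian_pos ζ
  have hM : ∀ x, 0 ≤ maxwellian x := fun x => by unfold maxwellian; positivity
  have t1 : maxwellian v' * √(maxwellian w') * B ≤ m * C *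
      (exp (-((‖η‖ ^ 2 + ‖v'‖ ^ 2) / 2)) * ‖η - ζ‖ ^ γ * (cos θ * sin θ)) := by
    calc _ ≤ (m * exp (-((‖η‖ ^ 2 + ‖v'‖ ^ 2) / 2))) *
          (C * (‖η - ζ‖ ^ γ * (cos θ * sin θ))) :=
          mul_le_mul (maxwellian_mul_sqrt_le henergy) hB1 hB0 (by positivity)
      _ = _ := by ring
  have t2 : √(maxwellian v') * maxwellian w' * B ≤ m * C *
      (exp (-((‖η‖ ^ 2 + ‖w'‖ ^ 2) / 2)) * ‖η - ζ‖ ^ γ * (cos θ * sin θ)) := by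
    calc _ = maxwellian w' * √(maxwellian v') * B := by ring
      _ ≤ (m * exp (-((‖η‖ ^ 2 + ‖w'‖ ^ 2) / 2))) *
          (C * (‖η - ζ‖ ^ γ * (cos θ * sin θ))) :=
          mul_le_mul (maxwellian_mul_sqrt_le ((add_comm _ _).trans henergy)) hB1 hB0
            (by positivity)
      _ = _ := by ring
  have t3 : maxwellian ζ * √(maxwellian η) * B ≤ m * C *
      (8 * (1 + ‖ζ‖)⁻¹ * exp (-(‖η‖ ^ 2 / 4))) := by
    have g1 : ‖η - ζ‖ ^ γ ≤ (1 + ‖η‖) * (1 + ‖ζ‖) := by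
      have hle : ‖η - ζ‖ ≤ (1 + ‖η‖) * (1 + ‖ζ‖) := by
        nlinarith [norm_sub_le η ζ, norm_nonneg η, norm_nonneg ζ]
      have h11 : 1 ≤ (1 + ‖η‖) * (1 + ‖ζ‖) := by nlinarith [norm_nonneg η, norm_nonneg ζ]
      calc _ ≤ ((1 + ‖η‖) * (1 + ‖ζ‖)) ^ γ := by gcongr
        _ ≤ ((1 + ‖η‖) * (1 + ‖ζ‖)) ^ (1 : ℝ) := rpow_le_rpow_of_exponent_le h11 h1.le
        _ = _ := rpow_one _
    -- One more factor 1 + |ζ| is absorbed to create the decay; three uses of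
    -- `one_add_le_two_mul_exp` give 8 and consume the whole Gaussian in ζ.
    have g2 : exp (-((‖η‖ ^ 2 + ‖ζ‖ ^ 2) / 2)) * ((1 + ‖η‖) * (1 + ‖ζ‖)) ≤
        8 * (1 + ‖ζ‖)⁻¹ * exp (-(‖η‖ ^ 2 / 4)) := by
      have k1 := one_add_le_two_mul_exp ‖η‖
      have k2 := one_add_le_two_mul_exp ‖ζ‖
      rw [mul_right_comm, ← div_eq_mul_inv, le_div_iff₀ (by positivity)]
      calc _ = exp (-((‖η‖ ^ 2 + ‖ζ‖ ^ 2) / 2)) * ((1 + ‖η‖) * ((1 + ‖ζ‖) * (1 + ‖ζ‖))) := by ring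
        _ ≤ exp (-((‖η‖ ^ 2 + ‖ζ‖ ^ 2) / 2)) * ((2 * exp (‖η‖ ^ 2 / 4)) *
            ((2 * exp (‖ζ‖ ^ 2 / 4)) * (2 * exp (‖ζ‖ ^ 2 / 4)))) := by gcongr
        _ = 8 * (exp (-((‖η‖ ^ 2 + ‖ζ‖ ^ 2) / 2)) * (exp (‖η‖ ^ 2 / 4) *
            (exp (‖ζ‖ ^ 2 / 4) * exp (‖ζ‖ ^ 2 / 4)))) := by ring
        _ = _ := by
            simp only [← exp_add]; congr 2; ring
    calc _ ≤ (m * exp (-((‖η‖ ^ 2 + ‖ζ‖ ^ 2) / 2))) *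
          (C * (((1 + ‖η‖) * (1 + ‖ζ‖)) * 1)) := by
          refine mul_le_mul ?_ (hB1.trans (by gcongr)) hB0 (by positivity)
          exact maxwellian_mul_sqrt_le rfl
      _ = m * C * (exp (-((‖η‖ ^ 2 + ‖ζ‖ ^ 2) / 2)) * ((1 + ‖η‖) * (1 + ‖ζ‖))) := by ring
      _ ≤ _ := by gcongr
  have key : ∀ {x b d : ℝ}, 0 ≤ x → x ≤ m * C * b →
      ‖x * d‖ₑ ≤ ENNReal.ofReal (m * C) * (ENNReal.ofReal b * ‖d‖ₑ) := by
    intro x b d hx hxb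
    rw [enorm_mul, Real.enorm_of_nonneg hx, ← mul_assoc, ← ENNReal.ofReal_mul (by positivity)]
    gcongr
  have e : nonlocalIntegrand γ β f ζ (η, ε, θ) =
      maxwellian v' * √(maxwellian w') * B * f w' + √(maxwellian v') * maxwellian w' * B * f v' -
        maxwellian ζ * √(maxwellian η) * B * f η := by
    unfold nonlocalIntegrand perturb
    ring
  rw [e, mul_add, mul_add, lossDensity, ← mul_assoc (ENNReal.ofReal (8 * _)),
    ← ENNReal.ofReal_mul (by positivity)]
  refine enorm_sub_le.trans (add_le_add ((enorm_add_le _ _).trans (add_le_add ?_ ?_)) ?_)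
  · exact key (mul_nonneg (mul_nonneg (hM _) (sqrt_nonneg _)) hB0) t1
  · exact key (mul_nonneg (mul_nonneg (sqrt_nonneg _) (hM _)) hB0) t2
  · exact key (mul_nonneg (mul_nonneg (hM _) (sqrt_nonneg _)) hB0) t3

theorem lintegral_exp_neg_norm_sq_ne_top {c : ℝ} (hc : 0 < c) :
    ∫⁻ η : E3, ENNReal.ofReal (exp (-(c * ‖η‖ ^ 2))) ≠ ∞ := by
  have e : ∀ a x y : ℝ, ENNReal.ofReal (exp (-(c * ‖cart (a, x, y)‖ ^ 2))) =
      ENNReal.ofReal (exp (-(c * a ^ 2))) * (ENNReal.ofReal (exp (-(c * x ^ 2))) *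
        ENNReal.ofReal (exp (-(c * y ^ 2)))) := fun a x y => by
    rw [← ENNReal.ofReal_mul (by positivity), ← ENNReal.ofReal_mul (by positivity), ← exp_add,
      ← exp_add, norm_sq_eq_coords]
    simp only [cart_zero_apply, cart_one_apply, cart_two_apply]
    ring_nf
  rw [lintegral_cart (by fun_prop)]
  simp_rw [e, lintegral_const_mul' _ _ ENNReal.ofReal_ne_top, lintegral_gaussian hc]
  rw [lintegral_mul_const _ (by fun_prop), lintegral_mul_const _ (by fun_prop),
    lintegral_gaussian hc]
  finiteness

theorem sq_lintegral_lossDensity_le {γ : ℝ} (h0 : 0 ≤ γ) {h : E3 → ℝ≥0∞} (hh : Measurable h) :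
    (∫⁻ η, lossDensity h η) ^ 2 ≤ (∫⁻ η : E3, ENNReal.ofReal (exp (-(2⁻¹ * ‖η‖ ^ 2)))) *
      ∫⁻ v, h v ^ 2 * ENNReal.ofReal ((1 + ‖v‖) ^ γ) := by
  unfold lossDensity
  refine (sq_lintegral_mul_le (by fun_prop) hh.aemeasurable).trans ?_
  gcongr with η v
  · rw [← ENNReal.ofReal_pow (exp_pos _).le, ← exp_nat_mul]
    refine ENNReal.ofReal_le_ofReal (le_of_eq ?_)
    push_cast; ring_nf
  · refine le_mul_of_one_le_right' ?_
    rw [← ENNReal.ofReal_one]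
    exact ENNReal.ofReal_le_ofReal (one_le_rpow (by linarith [norm_nonneg v]) h0)

theorem add_sq_le_four_mul (a b : ℝ≥0∞) : (a + b) ^ 2 ≤ 4 * (a ^ 2 + b ^ 2) := by
  rcases le_total a b with h | h
  · calc _ ≤ (b + b) ^ 2 := by gcongr
      _ = 4 * (0 + b ^ 2) := by ring
      _ ≤ _ := by gcongr; exact zero_le
  · calc _ ≤ (a + a) ^ 2 := by gcongr
      _ = 4 * (a ^ 2 + 0) := by ring
      _ ≤ _ := by gcongr; exact zero_le

/-- The integrand of `√M · K f` is controlled by a weighted `L²` norm of `f`. -/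
theorem exists_sq_lintegral_nonlocalIntegrand_le {γ : ℝ} {β : ℝ → ℝ}
    (hB : IsCutoffPotential γ β) : ∃ C : ℝ≥0∞, C ≠ ∞ ∧ ∀ (f : E3 → ℝ), Measurable f → ∀ ζ : E3,
      (∫⁻ p, ‖nonlocalIntegrand γ β f ζ p‖ₑ ∂collisionMeasure) ^ 2 ≤
        ENNReal.ofReal (√(maxwellian ζ)) ^ 2 * (C * ENNReal.ofReal ((1 + ‖ζ‖) ^ (-2 : ℝ)) *
          ∫⁻ v, ‖f v‖ₑ ^ 2 * ENNReal.ofReal ((1 + ‖v‖) ^ γ)) := by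
  have h0 := hB.nonneg_gamma
  have h1 := hB.gamma_lt_one
  obtain ⟨b, hb⟩ := hB.bound_beta
  have hbC : ∀ θ ∈ Ioo (0 : ℝ) (π / 2), 0 ≤ β θ ∧ β θ ≤ max b 0 * (cos θ * sin θ) :=
    fun θ hp => ⟨(hb θ hp).1, (hb θ hp).2.trans (mul_le_mul_of_nonneg_right (le_max_left _ _)
      (mul_nonneg (cos_nonneg_of_mem_Icc ⟨by linarith [hp.1, pi_pos], hp.2.le⟩)
        (sin_nonneg_of_nonneg_of_le_pi hp.1.le (by linarith [hp.2, pi_pos]))))⟩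
  set c := max b 0 with hc
  have hc0 : 0 ≤ c := le_max_right _ _
  obtain ⟨G, hGt, hG⟩ := exists_gainIntegral_sq_le h0 h1
  set E := ∫⁻ η : E3, ENNReal.ofReal (exp (-(2⁻¹ * ‖η‖ ^ 2))) with hE
  have hEt : E ≠ ∞ := lintegral_exp_neg_norm_sq_ne_top (by norm_num)
  -- The measure of the angular domain, on which the loss majorant is constant.
  set A : ℝ≥0∞ := ENNReal.ofReal (2 * π) * ENNReal.ofReal (π / 2) with hA
  refine ⟨ENNReal.ofReal c ^ 2 * (4 * (4 * G + (8 * A) ^ 2 * E)), by finiteness,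
    fun f hf ζ => ?_⟩
  set h : E3 → ℝ≥0∞ := fun v => ‖f v‖ₑ with hh
  have hhm : Measurable h := hf.enorm
  set N := ∫⁻ v, ‖f v‖ₑ ^ 2 * ENNReal.ofReal ((1 + ‖v‖) ^ γ) with hN
  have hlm : Measurable (lossDensity h) := by unfold lossDensity; fun_prop
  have hloss : ∫⁻ p : E3 × ℝ × ℝ, lossDensity h p.1 ∂collisionMeasure =
      A * ∫⁻ η, lossDensity h η := by
    rw [lintegral_collisionMeasure (by fun_prop), ← lintegral_const_mul _ hlm]
    refine lintegral_congr fun η => ?_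
    simp [hA]
    ring
  have hle : ∫⁻ p, ‖nonlocalIntegrand γ β f ζ p‖ₑ ∂collisionMeasure ≤
      ENNReal.ofReal (√(maxwellian ζ) * c) * (2 * gainIntegral γ h ζ +
        ENNReal.ofReal (8 * (1 + ‖ζ‖)⁻¹) * (A * ∫⁻ η, lossDensity h η)) := by
    have m1 : Measurable fun p : E3 × ℝ × ℝ =>
        gainDensity γ h ζ (p.1 - ζ) (π / 2 - p.2.2) (p.2.1 + π) :=
      measurable_gainDensity γ hhm (by fun_prop) (by fun_prop) (by fun_prop) (by fun_prop)
    have m2 : Measurable fun p : E3 × ℝ × ℝ => gainDensity γ h ζ (p.1 - ζ) p.2.2 p.2.1 :=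
      measurable_gainDensity γ hhm (by fun_prop) (by fun_prop) (by fun_prop) (by fun_prop)
    calc _ ≤ ∫⁻ p, ENNReal.ofReal (√(maxwellian ζ) * c) *
          (gainDensity γ h ζ (p.1 - ζ) (π / 2 - p.2.2) (p.2.1 + π) +
            gainDensity γ h ζ (p.1 - ζ) p.2.2 p.2.1 +
            ENNReal.ofReal (8 * (1 + ‖ζ‖)⁻¹) * lossDensity h p.1) ∂collisionMeasure := by
          refine lintegral_mono_ae ?_
          filter_upwards [ae_collisionMeasure_mem,
            ae_collisionMeasure_of_ae (Measure.ae_ne volume ζ)] with p hp hne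
          exact enorm_nonlocalIntegrand_le h0 h1 hc0 hbC f hne hp.2
      _ = _ := by
          rw [lintegral_const_mul' _ _ ENNReal.ofReal_ne_top, lintegral_add_left (by exact m1.add m2),
            lintegral_add_left m1, lintegral_gainDensity _ hhm, lintegral_gainDensity_swap _ hhm,
            lintegral_const_mul' _ _ ENNReal.ofReal_ne_top, hloss, two_mul]
  have hinv : ENNReal.ofReal (8 * (1 + ‖ζ‖)⁻¹) ^ 2 =
      8 ^ 2 * ENNReal.ofReal ((1 + ‖ζ‖) ^ (-2 : ℝ)) := by
    rw [ENNReal.ofReal_mul (by norm_num), ENNReal.ofReal_ofNat, mul_pow,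
      ← ENNReal.ofReal_pow (by positivity), rpow_neg (by positivity), inv_pow]
    norm_cast
  refine (pow_le_pow_left' hle 2).trans ?_
  rw [mul_pow, ENNReal.ofReal_mul (sqrt_nonneg _), mul_pow, mul_assoc (_ ^ 2)]
  refine mul_le_mul_right ?_ _
  calc _ ≤ ENNReal.ofReal c ^ 2 * (4 * ((2 * gainIntegral γ h ζ) ^ 2 +
        (ENNReal.ofReal (8 * (1 + ‖ζ‖)⁻¹) * (A * ∫⁻ η, lossDensity h η)) ^ 2)) := by
        gcongr; exact add_sq_le_four_mul _ _
    _ = ENNReal.ofReal c ^ 2 * (4 * (4 * gainIntegral γ h ζ ^ 2 +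
        8 ^ 2 * ENNReal.ofReal ((1 + ‖ζ‖) ^ (-2 : ℝ)) * A ^ 2 *
          (∫⁻ η, lossDensity h η) ^ 2)) := by
        rw [mul_pow (ENNReal.ofReal (8 * _)), hinv]; ring
    _ ≤ ENNReal.ofReal c ^ 2 * (4 * (4 * (G * ENNReal.ofReal ((1 + ‖ζ‖) ^ (-2 : ℝ)) * N) +
        8 ^ 2 * ENNReal.ofReal ((1 + ‖ζ‖) ^ (-2 : ℝ)) * A ^ 2 * (E * N))) := by
        gcongr
        · exact hG ζ h hhm
        · exact sq_lintegral_lossDensity_le h0 hhm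
    _ = _ := by ring

/-! ### Bounds for the collision frequency -/

theorem integrable_exp_neg_norm_sq {c : ℝ} (hc : 0 < c) :
    Integrable fun η : E3 => exp (-(c * ‖η‖ ^ 2)) := by
  refine ⟨by fun_prop, ?_⟩
  rw [hasFiniteIntegral_iff_ofReal (.of_forall fun _ => (exp_pos _).le)]
  exact (lintegral_exp_neg_norm_sq_ne_top hc).lt_top

theorem setIntegral_beta_pos {γ : ℝ} {β : ℝ → ℝ} (hB : IsCutoffPotential γ β) :
    0 < ∫ θ in Ioo (0 : ℝ) (π / 2), β θ := by
  obtain ⟨C, hC⟩ := hB.bound_beta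
  have hnn : 0 ≤ᵐ[volume.restrict (Ioo (0 : ℝ) (π / 2))] β :=
    (ae_restrict_iff' measurableSet_Ioo).2 (.of_forall fun θ hθ => (hC θ hθ).1)
  have hint : Integrable β (volume.restrict (Ioo (0 : ℝ) (π / 2))) := by
    refine Integrable.of_bound hB.measurable_beta.aestronglyMeasurable |C|
      ((ae_restrict_iff' measurableSet_Ioo).2 (.of_forall fun θ hθ => ?_))
    rw [norm_of_nonneg (hC θ hθ).1]
    refine (hC θ hθ).2.trans ((le_abs_self _).trans ?_)
    rw [abs_mul, abs_mul]
    exact mul_le_of_le_one_right (abs_nonneg C)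
      (mul_le_one₀ (abs_cos_le_one θ) (abs_nonneg _) (abs_sin_le_one θ))
  refine (integral_nonneg_of_ae hnn).lt_of_ne fun h => hB.nontrivial_beta ?_
  exact (integral_eq_zero_iff_of_nonneg_ae hnn hint).1 h.symm

theorem norm_sub_rpow_le {γ : ℝ} (h0 : 0 ≤ γ) (h1 : γ < 1) (η ζ : E3) :
    ‖η - ζ‖ ^ γ ≤ (1 + ‖η‖) * (1 + ‖ζ‖) ^ γ := by
  calc _ ≤ ((1 + ‖η‖) * (1 + ‖ζ‖)) ^ γ := by
        gcongr
        nlinarith [norm_sub_le η ζ, norm_nonneg η, norm_nonneg ζ]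
    _ = (1 + ‖η‖) ^ γ * (1 + ‖ζ‖) ^ γ := mul_rpow (by positivity) (by positivity)
    _ ≤ (1 + ‖η‖) ^ (1 : ℝ) * (1 + ‖ζ‖) ^ γ := by
        gcongr
        linarith [norm_nonneg η]
    _ = _ := by rw [rpow_one]

theorem exp_mul_norm_sub_rpow_le {γ : ℝ} (h0 : 0 ≤ γ) (h1 : γ < 1) (η ζ : E3) :
    exp (-‖η‖ ^ 2) * ‖η - ζ‖ ^ γ ≤ 2 * exp (-(2⁻¹ * ‖η‖ ^ 2)) * (1 + ‖ζ‖) ^ γ := by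
  have h2 : exp (-‖η‖ ^ 2) * (1 + ‖η‖) ≤ 2 * exp (-(2⁻¹ * ‖η‖ ^ 2)) := by
    calc _ ≤ exp (-‖η‖ ^ 2) * (2 * exp (‖η‖ ^ 2 / 4)) := by
          gcongr; exact one_add_le_two_mul_exp _
      _ = 2 * exp (-‖η‖ ^ 2 + ‖η‖ ^ 2 / 4) := by rw [exp_add]; ring
      _ ≤ _ := by
          gcongr
          nlinarith [sq_nonneg ‖η‖]
  calc _ ≤ exp (-‖η‖ ^ 2) * ((1 + ‖η‖) * (1 + ‖ζ‖) ^ γ) := by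
        gcongr; exact norm_sub_rpow_le h0 h1 η ζ
    _ = exp (-‖η‖ ^ 2) * (1 + ‖η‖) * (1 + ‖ζ‖) ^ γ := by ring
    _ ≤ _ := by gcongr

theorem integrable_exp_mul_norm_sub_rpow {γ : ℝ} (h0 : 0 ≤ γ) (h1 : γ < 1) (ζ : E3) :
    Integrable fun η : E3 => exp (-‖η‖ ^ 2) * ‖η - ζ‖ ^ γ := by
  refine Integrable.mono' (((integrable_exp_neg_norm_sq (c := 2⁻¹) (by norm_num)).const_mul
    2).mul_const ((1 + ‖ζ‖) ^ γ)) (by fun_prop) (.of_forall fun η => ?_)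
  rw [norm_of_nonneg (by positivity)]
  exact exp_mul_norm_sub_rpow_le h0 h1 η ζ

/-- One term alone may vanish, but the larger of |η - ζ| and |η + ζ| is at least half of |η| + |ζ|.
Averaging over η and -η then bounds the collision frequency from below. -/
theorem le_norm_sub_rpow_add {γ : ℝ} (h0 : 0 ≤ γ) (h1 : γ < 1) (η ζ : E3) :
    2⁻¹ * min ‖η‖ 1 * (1 + ‖ζ‖) ^ γ ≤ ‖η - ζ‖ ^ γ + ‖-η - ζ‖ ^ γ := by
  set t := min ‖η‖ 1
  have ht0 : 0 ≤ t := le_min (norm_nonneg η) zero_le_one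
  have ht1 : t ≤ 1 := min_le_right _ _
  have htη : t ≤ ‖η‖ := min_le_left _ _
  have hn : ‖-η - ζ‖ = ‖η + ζ‖ := by rw [← norm_neg]; congr 1; abel
  have hsum : ‖η‖ + ‖ζ‖ ≤ ‖η - ζ‖ + ‖-η - ζ‖ := by
    rw [hn]
    have a1 : 2 * ‖η‖ ≤ ‖η - ζ‖ + ‖η + ζ‖ := by
      calc 2 * ‖η‖ = ‖(η - ζ) + (η + ζ)‖ := by
            rw [sub_add_add_cancel, ← two_smul ℝ, norm_smul]; simp
        _ ≤ _ := norm_add_le _ _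
    have a2 : 2 * ‖ζ‖ ≤ ‖η - ζ‖ + ‖η + ζ‖ := by
      calc 2 * ‖ζ‖ = ‖(η + ζ) - (η - ζ)‖ := by
            rw [add_sub_sub_cancel, ← two_smul ℝ, norm_smul]; simp
        _ ≤ ‖η + ζ‖ + ‖η - ζ‖ := norm_sub_le _ _
        _ = _ := add_comm _ _
    linarith
  have key : ∀ y : ℝ, 0 ≤ y → ‖η‖ + ‖ζ‖ ≤ 2 * y → 2⁻¹ * t * (1 + ‖ζ‖) ^ γ ≤ y ^ γ := by
    intro y hy hle
    have h2 : 2⁻¹ * t * (1 + ‖ζ‖) ≤ y := by nlinarith [norm_nonneg ζ]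
    calc _ ≤ (2⁻¹ * t) ^ γ * (1 + ‖ζ‖) ^ γ := by
          gcongr
          rcases ht0.eq_or_lt with h | h
          · rw [← h]; simp; positivity
          · calc 2⁻¹ * t = (2⁻¹ * t) ^ (1 : ℝ) := (rpow_one _).symm
              _ ≤ _ := rpow_le_rpow_of_exponent_ge (by positivity) (by linarith) h1.le
      _ = (2⁻¹ * t * (1 + ‖ζ‖)) ^ γ := (mul_rpow (by positivity) (by positivity)).symm
      _ ≤ _ := by gcongr
  rcases le_total ‖η - ζ‖ ‖-η - ζ‖ with h | h
  · exact (key _ (norm_nonneg _) (by linarith)).trans (le_add_of_nonneg_left (by positivity))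
  · exact (key _ (norm_nonneg _) (by linarith)).trans (le_add_of_nonneg_right (by positivity))

theorem exists_collisionFreq_bounds {γ : ℝ} {β : ℝ → ℝ} (hB : IsCutoffPotential γ β) :
    ∃ c C : ℝ, 0 < c ∧ 0 < C ∧ ∀ ζ : E3, c * (1 + ‖ζ‖) ^ γ ≤ collisionFreq γ β ζ ∧
      collisionFreq γ β ζ ≤ C * (1 + ‖ζ‖) ^ γ := by
  have h0 := hB.nonneg_gamma
  have h1 := hB.gamma_lt_one
  set b := 2 * π ^ (-(1 / 2) : ℝ) * (∫ θ in Ioo (0 : ℝ) (π / 2), β θ) with hb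
  have hb0 : 0 < b := mul_pos (by positivity) (setIntegral_beta_pos hB)
  set A := ∫ η : E3, 2 * exp (-(2⁻¹ * ‖η‖ ^ 2)) with hA
  have hAi : Integrable fun η : E3 => 2 * exp (-(2⁻¹ * ‖η‖ ^ 2)) :=
    (integrable_exp_neg_norm_sq (c := 2⁻¹) (by norm_num)).const_mul 2
  have hA0 : 0 < A := by
    refine (integral_pos_iff_support_of_nonneg (fun η => by positivity) hAi).2 ?_
    have : Function.support (fun η : E3 => 2 * exp (-(2⁻¹ * ‖η‖ ^ 2))) = univ := by
      ext η; simp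
    rw [this]
    exact Measure.measure_univ_pos.2 (NeZero.ne _)
  have hGi : Integrable fun η : E3 => exp (-‖η‖ ^ 2) * (2⁻¹ * min ‖η‖ 1) := by
    refine Integrable.mono' (integrable_exp_neg_norm_sq one_pos) (by fun_prop)
      (.of_forall fun η => ?_)
    rw [norm_of_nonneg (by positivity), one_mul]
    exact mul_le_of_le_one_right (exp_pos _).le (by linarith [min_le_right ‖η‖ 1])
  set G := ∫ η : E3, exp (-‖η‖ ^ 2) * (2⁻¹ * min ‖η‖ 1) with hG
  have hG0 : 0 < G := by
    refine (integral_pos_iff_support_of_nonneg (fun η => by positivity) hGi).2 ?_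
    have : Function.support (fun η : E3 => exp (-‖η‖ ^ 2) * (2⁻¹ * min ‖η‖ 1)) = {0}ᶜ := by
      ext η
      simp only [Function.mem_support, ne_eq, mem_compl_iff, mem_singleton_iff]
      constructor
      · rintro h rfl; simp at h
      · intro h
        have := norm_pos_iff.2 h
        have : 0 < min ‖η‖ 1 := lt_min this one_pos
        positivity
    rw [this]
    exact isOpen_compl_singleton.measure_pos _ ⟨axis, fun h => by
      have := norm_axis; rw [h] at this; simp at this⟩
  refine ⟨b * (2⁻¹ * G), b * A, by positivity, by positivity, fun ζ => ?_⟩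
  have hi := integrable_exp_mul_norm_sub_rpow h0 h1 ζ
  rw [collisionFreq_eq, ← hb]
  constructor
  · have hneg : ∫ η : E3, exp (-‖η‖ ^ 2) * ‖-η - ζ‖ ^ γ =
        ∫ η : E3, exp (-‖η‖ ^ 2) * ‖η - ζ‖ ^ γ := by
      have := integral_neg_eq_self (fun η : E3 => exp (-‖η‖ ^ 2) * ‖η - ζ‖ ^ γ) volume
      simpa only [norm_neg] using this
    have hi' : Integrable fun η : E3 => exp (-‖η‖ ^ 2) * ‖-η - ζ‖ ^ γ := by
      simpa only [norm_neg] using hi.comp_neg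
    have : G * (1 + ‖ζ‖) ^ γ ≤ 2 * ∫ η : E3, exp (-‖η‖ ^ 2) * ‖η - ζ‖ ^ γ := by
      rw [two_mul]
      nth_rewrite 2 [← hneg]
      rw [← integral_add hi hi', hG, ← integral_mul_const]
      refine integral_mono (hGi.mul_const _) (hi.add hi') fun η => ?_
      simp only
      rw [← mul_add, mul_assoc]
      gcongr
      exact le_norm_sub_rpow_add h0 h1 η ζ
    rw [mul_assoc b]
    gcongr
    linarith
  · rw [mul_assoc b, hA, ← integral_mul_const]
    refine mul_le_mul_of_nonneg_left (integral_mono hi (hAi.mul_const _) fun η => ?_) hb0.le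
    exact exp_mul_norm_sub_rpow_le h0 h1 η ζ

@[fun_prop]
theorem measurable_collisionFreq (γ : ℝ) (β : ℝ → ℝ) : Measurable (collisionFreq γ β) := by
  have : collisionFreq γ β = fun ζ => 2 * π ^ (-(1 / 2) : ℝ) * (∫ θ in Ioo (0 : ℝ) (π / 2), β θ) *
      ∫ η : E3, exp (-‖η‖ ^ 2) * ‖η - ζ‖ ^ γ := funext fun ζ => collisionFreq_eq γ β ζ
  rw [this]
  have h2 : StronglyMeasurable fun ζ : E3 => ∫ η : E3, exp (-‖η‖ ^ 2) * ‖η - ζ‖ ^ γ := by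
    refine StronglyMeasurable.integral_prod_right' (f := fun q : E3 × E3 =>
      exp (-‖q.2‖ ^ 2) * ‖q.2 - q.1‖ ^ γ) (Measurable.stronglyMeasurable ?_)
    fun_prop
  exact h2.measurable.const_mul _

/-! ### The integral operator on weighted `L²` spaces -/

/-- The square of `normLStar`. -/
noncomputable def sqNorm (γ : ℝ) (β : ℝ → ℝ) (g : E3 → ℝ) : ℝ≥0∞ :=
  ∫⁻ ζ, ENNReal.ofReal (|g ζ| ^ 2 * collisionFreq γ β ζ)

theorem normLStar_sq (γ : ℝ) (β : ℝ → ℝ) (g : E3 → ℝ) :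
    normLStar γ β g ^ 2 = sqNorm γ β g := by
  unfold normLStar sqNorm
  rw [← ENNReal.rpow_two, ← ENNReal.rpow_mul]
  norm_num

theorem sqNorm_congr (γ : ℝ) (β : ℝ → ℝ) {f g : E3 → ℝ} (h : f =ᵐ[volume] g) :
    sqNorm γ β f = sqNorm γ β g :=
  lintegral_congr_ae (h.mono fun v hv => by simp only [hv])

/-- The lower bound for ν converts the weight (1+|v|)^γ into ν. Measurability up to null sets
suffices, because the collision integrand depends only on the class of `f`. -/
theorem exists_sq_lintegral_nonlocalIntegrand_le_sqNorm {γ : ℝ} {β : ℝ → ℝ}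
    (hB : IsCutoffPotential γ β) : ∃ C : ℝ≥0∞, C ≠ ∞ ∧ ∀ (f : E3 → ℝ), AEMeasurable f →
      ∀ ζ : E3, (∫⁻ p, ‖nonlocalIntegrand γ β f ζ p‖ₑ ∂collisionMeasure) ^ 2 ≤
        ENNReal.ofReal (√(maxwellian ζ)) ^ 2 *
          (C * ENNReal.ofReal ((1 + ‖ζ‖) ^ (-2 : ℝ)) * sqNorm γ β f) := by
  obtain ⟨C, hC, h⟩ := exists_sq_lintegral_nonlocalIntegrand_le hB
  obtain ⟨c, _, hc, _, hν⟩ := exists_collisionFreq_bounds hB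
  refine ⟨C * ENNReal.ofReal c⁻¹, by finiteness, fun f hf ζ => ?_⟩
  have e1 := nonlocalIntegrand_ae_congr γ β hf.ae_eq_mk ζ
  rw [lintegral_congr_ae (e1.mono fun p hp => by simp only [hp] :
    (fun p => ‖nonlocalIntegrand γ β f ζ p‖ₑ) =ᵐ[collisionMeasure]
      fun p => ‖nonlocalIntegrand γ β (hf.mk f) ζ p‖ₑ),
    sqNorm_congr γ β hf.ae_eq_mk]
  refine (h _ hf.measurable_mk ζ).trans ?_
  rw [mul_assoc C, mul_assoc, mul_assoc, mul_left_comm (ENNReal.ofReal c⁻¹)]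
  gcongr
  unfold sqNorm
  rw [← lintegral_const_mul' _ _ ENNReal.ofReal_ne_top]
  refine lintegral_mono fun v => ?_
  rw [← ofReal_norm, ← ENNReal.ofReal_pow (norm_nonneg _),
    ← ENNReal.ofReal_mul (by positivity), ← ENNReal.ofReal_mul (by positivity)]
  refine ENNReal.ofReal_le_ofReal ?_
  rw [norm_eq_abs, mul_left_comm]
  gcongr
  rw [inv_mul_eq_div, le_div_iff₀ hc, mul_comm]
  exact (hν v).1

theorem measurable_nonlocalIntegrand_apply (γ : ℝ) {β : ℝ → ℝ} (hβ : Measurable β)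
    {f : E3 → ℝ} (hf : Measurable f) (ζ : E3) : Measurable (nonlocalIntegrand γ β f ζ) := by
  unfold nonlocalIntegrand crossSection perturb
  fun_prop

theorem integrable_nonlocalIntegrand {γ : ℝ} {β : ℝ → ℝ} (hB : IsCutoffPotential γ β)
    {f : E3 → ℝ} (hf : AEMeasurable f) (hfin : sqNorm γ β f ≠ ∞) (ζ : E3) :
    Integrable (nonlocalIntegrand γ β f ζ) collisionMeasure := by
  obtain ⟨C, hC, h⟩ := exists_sq_lintegral_nonlocalIntegrand_le_sqNorm hB
  constructor
  · have hm : Measurable (nonlocalIntegrand γ β (hf.mk f) ζ) :=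
      measurable_nonlocalIntegrand_apply γ hB.measurable_beta hf.measurable_mk ζ
    exact hm.aestronglyMeasurable.congr (nonlocalIntegrand_ae_congr γ β hf.ae_eq_mk ζ).symm
  · have h2 := h f hf ζ
    have : (∫⁻ p, ‖nonlocalIntegrand γ β f ζ p‖ₑ ∂collisionMeasure) ^ 2 < ∞ :=
      h2.trans_lt (by finiteness)
    rw [hasFiniteIntegral_iff_enorm]
    by_contra hc
    rw [not_lt, top_le_iff] at hc
    simp [hc] at this

theorem exists_enorm_integralOp_sq_le {γ : ℝ} {β : ℝ → ℝ} (hB : IsCutoffPotential γ β) :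
    ∃ C : ℝ≥0∞, C ≠ ∞ ∧ ∀ (f : E3 → ℝ), AEMeasurable f → ∀ ζ : E3,
      ‖integralOp γ β f ζ‖ₑ ^ 2 ≤ C * ENNReal.ofReal ((1 + ‖ζ‖) ^ (-2 : ℝ)) * sqNorm γ β f := by
  obtain ⟨C, hC, h⟩ := exists_sq_lintegral_nonlocalIntegrand_le_sqNorm hB
  refine ⟨C, hC, fun f hf ζ => ?_⟩
  have hm := sqrt_maxwellian_pos ζ
  unfold integralOp
  rw [enorm_mul, mul_pow, Real.enorm_of_nonneg (by positivity)]
  calc _ ≤ ENNReal.ofReal (√(maxwellian ζ))⁻¹ ^ 2 *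
        (ENNReal.ofReal (√(maxwellian ζ)) ^ 2 *
          (C * ENNReal.ofReal ((1 + ‖ζ‖) ^ (-2 : ℝ)) * sqNorm γ β f)) := by
        gcongr
        exact (pow_le_pow_left' (enorm_integral_le_lintegral_enorm _) 2).trans (h f hf ζ)
    _ = _ := by
        rw [← mul_assoc, ← mul_pow, ← ENNReal.ofReal_mul (by positivity),
          inv_mul_cancel₀ hm.ne']
        simp

theorem measurable_integralOp (γ : ℝ) {β : ℝ → ℝ} (hβ : Measurable β) {X : Type*}
    [MeasurableSpace X] {f : X → E3 → ℝ} (hf : Measurable fun q : X × E3 => f q.1 q.2) :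
    Measurable fun q : X × E3 => integralOp γ β (f q.1) q.2 := by
  have h1 : Measurable fun w : (X × E3) × E3 × ℝ × ℝ =>
      nonlocalIntegrand γ β (f w.1.1) w.1.2 w.2 :=
    measurable_nonlocalIntegrand γ hβ (X := X × E3) (f := fun q => f q.1) (a := fun q => q.2)
      (hf.comp (by fun_prop : Measurable fun q : (X × E3) × E3 => (q.1.1, q.2))) measurable_snd
  have : SFinite collisionMeasure := by rw [collisionMeasure_eq]; infer_instance
  have h2 := (h1.stronglyMeasurable.integral_prod_right' (ν := collisionMeasure)).measurable
  unfold integralOp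
  fun_prop

/-! ### Backward trajectories -/

theorem exitTime_nonneg (Ω : Set E3) (x ζ : E3) : 0 ≤ exitTime Ω x ζ :=
  Real.sInf_nonneg fun _ ht => ht.1.le

/-- A segment from a point of Ω to a point outside is connected, so it meets the boundary, at a
positive time because Ω is open; the exit time would then be at most `s`. -/
theorem sub_smul_mem_of_lt_exitTime {Ω : Set E3} (hΩ : IsOpen Ω) {x ζ : E3} (hx : x ∈ Ω) {s : ℝ}
    (hs0 : 0 < s) (hs : s < exitTime Ω x ζ) : x - s • ζ ∈ Ω := by
  by_contra hc
  have hconn : IsPreconnected ((fun t : ℝ => x - t • ζ) '' Icc 0 s) :=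
    isPreconnected_Icc.image _ (by fun_prop)
  have hne : ((fun t : ℝ => x - t • ζ) '' Icc 0 s ∩ frontier Ω).Nonempty := by
    by_contra hemp
    have hnf : ∀ t ∈ Icc 0 s, x - t • ζ ∉ frontier Ω := fun t ht hf =>
      hemp ⟨_, mem_image_of_mem _ ht, hf⟩
    have hcl : ∀ t ∈ Icc 0 s, x - t • ζ ∉ Ω → x - t • ζ ∈ (closure Ω)ᶜ := fun t ht h => by
      rw [closure_eq_self_union_frontier]
      exact fun h' => h'.elim h (hnf t ht)
    have hmem : ∀ t ∈ Icc 0 s, x - t • ζ ∈ Ω ∪ (closure Ω)ᶜ := fun t ht =>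
      or_iff_not_imp_left.2 (hcl t ht)
    obtain ⟨y, -, hy, hy'⟩ := hconn Ω (closure Ω)ᶜ hΩ isClosed_closure.isOpen_compl
      (by rintro _ ⟨t, ht, rfl⟩; exact hmem t ht)
      ⟨x, ⟨0, ⟨le_rfl, hs0.le⟩, by simp⟩, hx⟩
      ⟨x - s • ζ, ⟨s, ⟨hs0.le, le_rfl⟩, rfl⟩, hcl s ⟨hs0.le, le_rfl⟩ hc⟩
    exact hy' (subset_closure hy)
  obtain ⟨_, ⟨t, ht, rfl⟩, hfr⟩ := hne
  have ht0 : t ≠ 0 := by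
    rintro rfl
    rw [hΩ.frontier_eq] at hfr
    exact hfr.2 (by simpa using hx)
  have : exitTime Ω x ζ ≤ t :=
    csInf_le ⟨0, fun _ h => h.1.le⟩ ⟨lt_of_le_of_ne ht.1 ht0.symm, hfr⟩
  linarith [ht.2]

/-- Openness lets `y` be pushed a little farther from `x`. Strictness is needed because the kernel
is cut off to the open interval (0, R). -/
theorem dist_lt_diam_of_isOpen {Ω : Set E3} (hΩ : IsOpen Ω) (hb : Bornology.IsBounded Ω)
    {x y : E3} (hx : x ∈ Ω) (hy : y ∈ Ω) (hne : x ≠ y) : dist x y < Metric.diam Ω := by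
  obtain ⟨r, hr, hball⟩ := Metric.isOpen_iff.1 hΩ y hy
  have hd : 0 < ‖y - x‖ := norm_pos_iff.2 (sub_ne_zero.2 hne.symm)
  set t := r / (2 * ‖y - x‖) with ht
  have ht0 : 0 < t := by positivity
  have hy' : y + t • (y - x) ∈ Ω := by
    refine hball ?_
    rw [Metric.mem_ball, dist_eq_norm, add_sub_cancel_left, norm_smul, norm_of_nonneg ht0.le, ht]
    field_simp
    linarith
  have h1 := Metric.dist_le_diam_of_mem hb hy' hx
  have h2 : dist (y + t • (y - x)) x = (1 + t) * ‖y - x‖ := by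
    rw [dist_eq_norm, show y + t • (y - x) - x = (1 + t) • (y - x) by module, norm_smul,
      norm_of_nonneg (by positivity)]
  rw [h2] at h1
  rw [dist_comm, dist_eq_norm]
  nlinarith

/-! ### Change of variables along trajectories -/

/-- Near 0 the integrand behaves like t^(α-1-δ), integrable exactly when δ < α; at infinity it
decays like t^(α-3). -/
theorem lintegral_Ioi_scaling_lt_top {α δ : ℝ} (h1 : α < 1) (hδ : δ < α) :
    ∫⁻ t in Ioi (0 : ℝ), ENNReal.ofReal (t ^ (α - 3) * (1 + t⁻¹) ^ (δ - 2)) ≠ ∞ := by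
  have hu : Ioi (0 : ℝ) = Ioc 0 1 ∪ Ioi 1 := (Ioc_union_Ioi_eq_Ioi zero_le_one).symm
  have i1 : IntegrableOn (fun t : ℝ => t ^ (α - 1 - δ)) (Ioc 0 1) :=
    (intervalIntegrable_iff_integrableOn_Ioc_of_le zero_le_one).1
      (intervalIntegral.intervalIntegrable_rpow' (by linarith))
  have i2 : IntegrableOn (fun t : ℝ => t ^ (α - 3)) (Ioi 1) :=
    integrableOn_Ioi_rpow_of_lt (by linarith) one_pos
  rw [hu]
  refine ((lintegral_union_le _ _ _).trans_lt (ENNReal.add_lt_top.2 ⟨?_, ?_⟩)).ne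
  · refine (setLIntegral_mono' measurableSet_Ioc fun t ht =>
      ENNReal.ofReal_le_ofReal ?_).trans_lt i1.lintegral_lt_top
    have ht0 : 0 < t := ht.1
    calc _ ≤ t ^ (α - 3) * (t⁻¹) ^ (δ - 2) := by
          refine mul_le_mul_of_nonneg_left ?_ (by positivity)
          exact rpow_le_rpow_of_nonpos (inv_pos.2 ht0) (by linarith) (by linarith)
      _ = t ^ (α - 1 - δ) := by
          rw [inv_rpow ht0.le, ← rpow_neg ht0.le, ← rpow_add ht0]; congr 1; ring
  · refine (setLIntegral_mono' measurableSet_Ioi fun t (ht : 1 < t) =>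
      ENNReal.ofReal_le_ofReal ?_).trans_lt i2.lintegral_lt_top
    have ht0 : 0 < t := one_pos.trans ht
    refine mul_le_of_le_one_right (by positivity) ?_
    refine rpow_le_one_of_one_le_of_nonpos ?_ (by linarith)
    linarith [inv_pos.2 ht0]

/-- Integration over the velocity and the time of a function of the position along the backward
trajectory. -/
theorem lintegral_trajectory (α δ : ℝ) {N : E3 → ℝ≥0∞} (hN : Measurable N) (x : E3) :
    ∫⁻ ζ : E3, ENNReal.ofReal ((1 + ‖ζ‖) ^ (δ - 2)) *
        ∫⁻ s in Ioi (0 : ℝ), ENNReal.ofReal (s ^ α) * N (x - s • ζ) =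
      (∫⁻ t in Ioi (0 : ℝ), ENNReal.ofReal (t ^ (α - 3) * (1 + t⁻¹) ^ (δ - 2))) *
        ∫⁻ y, ENNReal.ofReal (‖y‖ ^ (α - 2)) * N (x - y) := by
  set D := ∫⁻ t in Ioi (0 : ℝ), ENNReal.ofReal (t ^ (α - 3) * (1 + t⁻¹) ^ (δ - 2)) with hD
  calc _ = ∫⁻ ζ : E3, ∫⁻ s in Ioi (0 : ℝ), ENNReal.ofReal ((1 + ‖ζ‖) ^ (δ - 2)) *
        (ENNReal.ofReal (s ^ α) * N (x - s • ζ)) :=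
        lintegral_congr fun ζ => (lintegral_const_mul' _ _ ENNReal.ofReal_ne_top).symm
    _ = ∫⁻ s in Ioi (0 : ℝ), ∫⁻ ζ : E3, ENNReal.ofReal ((1 + ‖ζ‖) ^ (δ - 2)) *
        (ENNReal.ofReal (s ^ α) * N (x - s • ζ)) := lintegral_lintegral_swap (by fun_prop)
    _ = ∫⁻ s in Ioi (0 : ℝ), ∫⁻ y : E3, ENNReal.ofReal (s ^ (α - 3) * (1 + ‖y‖ / s) ^ (δ - 2)) *
        N (x - y) := by
        -- Substitution y = sζ at fixed time, with Jacobian s⁻³.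
        refine setLIntegral_congr_fun measurableSet_Ioi fun s (hs : 0 < s) => ?_
        have h := lintegral_smul_E3 (fun z => ENNReal.ofReal ((1 + ‖z‖ / s) ^ (δ - 2)) *
          (ENNReal.ofReal (s ^ α) * N (x - z))) hs
        have e : ∀ ζ : E3, ‖s • ζ‖ / s = ‖ζ‖ := fun ζ => by
          rw [norm_smul, norm_of_nonneg hs.le]; field_simp
        simp only [e] at h
        rw [h, ← lintegral_const_mul' _ _ ENNReal.ofReal_ne_top]
        refine lintegral_congr fun y => ?_
        have e3 : s ^ (α - 3) = s⁻¹ ^ 3 * s ^ α := by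
          rw [rpow_sub hs, div_eq_inv_mul, inv_pow]; norm_cast
        rw [e3, ENNReal.ofReal_mul (by positivity), ENNReal.ofReal_mul (by positivity)]
        ring
    _ = ∫⁻ y : E3, ∫⁻ s in Ioi (0 : ℝ), ENNReal.ofReal (s ^ (α - 3) * (1 + ‖y‖ / s) ^ (δ - 2)) *
        N (x - y) := lintegral_lintegral_swap (by fun_prop)
    _ = ∫⁻ y : E3, D * (ENNReal.ofReal (‖y‖ ^ (α - 2)) * N (x - y)) := by
        refine lintegral_congr_ae ((Measure.ae_ne volume (0 : E3)).mono fun y hy => ?_)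
        have hr : 0 < ‖y‖ := norm_pos_iff.2 hy
        simp only
        rw [lintegral_mul_const _ (by fun_prop), ← mul_assoc]
        congr 1
        -- Substitution s = ‖y‖ t, which pulls out ‖y‖^(α-3) and the Jacobian ‖y‖.
        rw [setLIntegral_Ioi_comp_mul _ hr, hD, mul_comm, ← lintegral_mul_const _ (by fun_prop),
          ← lintegral_mul_const _ (by fun_prop)]
        refine setLIntegral_congr_fun measurableSet_Ioi fun t (ht : 0 < t) => ?_
        rw [← ENNReal.ofReal_mul (by positivity), ← ENNReal.ofReal_mul (by positivity)]
        congr 1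
        rw [show ‖y‖ / (‖y‖ * t) = t⁻¹ by field_simp, mul_rpow hr.le ht.le,
          show α - 2 = α - 3 + 1 by ring, rpow_add_one hr.ne']
        ring
    _ = _ := lintegral_const_mul _ (by fun_prop)

theorem ae_trajectory_of_ae {P : E3 → Prop} (hP : ∀ᵐ y, P y) (x : E3) :
    ∀ᵐ ζ : E3, ∀ᵐ s ∂volume.restrict (Ioi (0 : ℝ)), P (x - s • ζ) := by
  set N := toMeasurable volume {v : E3 | ¬ P v} with hN
  have hN0 : volume N = 0 := by rw [hN, measure_toMeasurable]; exact hP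
  have hNm : MeasurableSet N := measurableSet_toMeasurable _ _
  set h : E3 → ℝ≥0∞ := N.indicator 1 with hh
  have hhm : Measurable h := measurable_one.indicator hNm
  have hP' : ∀ v, h v = 0 → P v := fun v hv => by
    by_contra hc
    have : v ∈ N := subset_toMeasurable _ _ hc
    simp [hh, indicator_of_mem this] at hv
  have hz : ∫⁻ y, ENNReal.ofReal (‖y‖ ^ ((0 : ℝ) - 2)) * h (x - y) = 0 := by
    refine (lintegral_congr_ae ?_).trans lintegral_zero
    have h1 : ∀ᵐ y, y ∉ N := measure_eq_zero_iff_ae_notMem.1 hN0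
    have h2 := (Measure.measurePreserving_sub_left volume x).quasiMeasurePreserving.ae h1
    filter_upwards [h2] with y hy
    simp [hh, indicator_of_notMem hy]
  -- With both exponents zero the scaling constant is infinite, which is harmless: it multiplies 0,
  -- and ∞ · 0 = 0 here.
  have hk := lintegral_trajectory 0 0 hhm x
  rw [hz, mul_zero, lintegral_eq_zero_iff (by
    refine Measurable.mul (by fun_prop) ?_
    exact Measurable.lintegral_prod_right' (f := fun q : E3 × ℝ =>
      ENNReal.ofReal (q.2 ^ (0 : ℝ)) * h (x - q.2 • q.1)) (by fun_prop))] at hk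
  filter_upwards [hk] with ζ hζ
  rw [Pi.zero_apply, mul_eq_zero, ENNReal.ofReal_eq_zero] at hζ
  have h3 := hζ.resolve_left (not_le.2 (by positivity))
  rw [lintegral_eq_zero_iff (by fun_prop)] at h3
  filter_upwards [h3] with s hs
  exact hP' _ (by simpa using hs)

/-! ### Integration in time -/

/-- Squaring gives exp(-2νt), of which exp(-νt) is enough; scaling t by ν leaves the integral for
Γ(1-α). -/
theorem lintegral_exp_mul_rpow_le {α ν : ℝ} (hν : 0 < ν) (s : Set ℝ) (hs : s ⊆ Ioi 0) :
    ∫⁻ t in s, ENNReal.ofReal (exp (-ν * t) * t ^ (-(α / 2))) ^ 2 ≤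
      ENNReal.ofReal (ν ^ (α - 1)) * ∫⁻ t in Ioi (0 : ℝ), ENNReal.ofReal (exp (-t) * t ^ (-α)) := by
  refine (lintegral_mono_set hs).trans ?_
  calc _ ≤ ∫⁻ t in Ioi (0 : ℝ), ENNReal.ofReal (exp (-(ν * t)) * t ^ (-α)) := by
        refine setLIntegral_mono' measurableSet_Ioi fun t (ht : 0 < t) => ?_
        rw [← ENNReal.ofReal_pow (by positivity), mul_pow, ← exp_nat_mul, ← rpow_natCast _ 2,
          ← rpow_mul ht.le]
        refine ENNReal.ofReal_le_ofReal ?_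
        have : 0 < ν * t := mul_pos hν ht
        have e : -(α / 2) * ((2 : ℕ) : ℝ) = -α := by push_cast; ring
        rw [e]
        gcongr
        push_cast
        nlinarith
    _ = _ := by
        rw [setLIntegral_Ioi_comp_mul _ (inv_pos.2 hν), ← lintegral_const_mul _ (by fun_prop),
          ← lintegral_const_mul _ (by fun_prop)]
        refine setLIntegral_congr_fun measurableSet_Ioi fun t (ht : 0 < t) => ?_
        rw [← ENNReal.ofReal_mul (by positivity), ← ENNReal.ofReal_mul (by positivity)]
        congr 1
        rw [mul_inv_cancel_left₀ hν.ne', mul_rpow (by positivity) ht.le, inv_rpow hν.le,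
          rpow_neg hν.le, inv_inv, rpow_sub_one hν.ne']
        field_simp

theorem lintegral_exp_neg_mul_rpow_ne_top {α : ℝ} (h1 : α < 1) :
    ∫⁻ t in Ioi (0 : ℝ), ENNReal.ofReal (exp (-t) * t ^ (-α)) ≠ ∞ := by
  have h := Real.GammaIntegral_convergent (s := 1 - α) (by linarith)
  rw [show 1 - α - 1 = -α by ring] at h
  exact (Integrable.lintegral_lt_top h).ne

/-- The Cauchy–Schwarz inequality in time, with the weight `s ^ α`. -/
theorem sq_lintegral_exp_mul_le {α ν : ℝ} (hν : 0 < ν) (τ : ℝ) {k : ℝ → ℝ≥0∞}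
    (hk : AEMeasurable k (volume.restrict (Ioc 0 τ))) :
    (∫⁻ s in Ioc 0 τ, ENNReal.ofReal (exp (-ν * s)) * k s) ^ 2 ≤
      ENNReal.ofReal (ν ^ (α - 1)) *
        (∫⁻ t in Ioi (0 : ℝ), ENNReal.ofReal (exp (-t) * t ^ (-α))) *
        ∫⁻ s in Ioc 0 τ, ENNReal.ofReal (s ^ α) * k s ^ 2 := by
  have e : ∫⁻ s in Ioc 0 τ, ENNReal.ofReal (exp (-ν * s)) * k s =
      ∫⁻ s in Ioc 0 τ, ENNReal.ofReal (exp (-ν * s) * s ^ (-(α / 2))) *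
        (ENNReal.ofReal (s ^ (α / 2)) * k s) := by
    refine setLIntegral_congr_fun measurableSet_Ioc fun s hs => ?_
    have hs0 : 0 < s := hs.1
    rw [← mul_assoc, ← ENNReal.ofReal_mul (by positivity), mul_assoc (exp _), ← rpow_add hs0]
    simp
  rw [e]
  refine (sq_lintegral_mul_le (by fun_prop) (by fun_prop)).trans ?_
  refine mul_le_mul' (lintegral_exp_mul_rpow_le hν _ fun s hs => hs.1)
    (setLIntegral_congr_fun measurableSet_Ioc fun s hs => ?_).le
  have hs0 : 0 < s := hs.1
  rw [mul_pow, ← ENNReal.ofReal_pow (by positivity), ← rpow_natCast _ 2, ← rpow_mul hs0.le]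
  simp

/-! ### Representatives of f and assembly of the estimate -/

/-- A jointly measurable representative of an element of `L^*_{x,ζ}`. -/
theorem MemLStar.exists_measurable_rep {γ : ℝ} {β : ℝ → ℝ} {Ω : Set E3} {f : E3 → E3 → ℝ}
    (hf : MemLStar γ β Ω f) : ∃ g : E3 → E3 → ℝ, (Measurable fun q : E3 × E3 => g q.1 q.2) ∧
      ∀ᵐ y ∂volume.restrict Ω, f y =ᵐ[volume] g y :=
  ⟨fun y v => hf.1.mk _ (y, v), hf.1.stronglyMeasurable_mk.measurable,
    Measure.ae_ae_of_ae_prod hf.1.ae_eq_mk⟩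

theorem measurable_sqNorm (γ : ℝ) (β : ℝ → ℝ) {g : E3 → E3 → ℝ}
    (hg : Measurable fun q : E3 × E3 => g q.1 q.2) : Measurable fun y => sqNorm γ β (g y) := by
  unfold sqNorm
  refine Measurable.lintegral_prod_right' (f := fun q : E3 × E3 =>
    ENNReal.ofReal (|g q.1 q.2| ^ 2 * collisionFreq γ β q.2)) ?_
  have : Measurable fun q : E3 × E3 => |g q.1 q.2| := hg.abs
  fun_prop

theorem MemLStar.ae_integrable {γ : ℝ} {β : ℝ → ℝ} (hB : IsCutoffPotential γ β) {Ω : Set E3}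
    {f : E3 → E3 → ℝ} (hf : MemLStar γ β Ω f) :
    ∀ᵐ y ∂(volume.restrict Ω), ∀ ζ : E3,
      Integrable (nonlocalIntegrand γ β (f y) ζ) collisionMeasure := by
  obtain ⟨g, hg, hfg⟩ := hf.exists_measurable_rep
  have hN := measurable_sqNorm γ β hg
  have hfin : ∀ᵐ y ∂(volume.restrict Ω), sqNorm γ β (g y) < ∞ := by
    refine ae_lt_top hN (ne_of_lt ((lintegral_congr_ae ?_).trans_lt hf.2))
    filter_upwards [hfg] with y hy
    exact (sqNorm_congr γ β hy).symm
  filter_upwards [hfg, hfin] with y hy hy' ζ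
  have hm : Measurable (g y) := hg.comp (measurable_const.prodMk measurable_id)
  refine integrable_nonlocalIntegrand hB ⟨g y, hm, hy⟩ ?_ ζ
  rw [sqNorm_congr γ β hy]
  exact hy'.ne

theorem enorm_mildIntegrand (γ : ℝ) (β : ℝ → ℝ) (f : E3 → E3 → ℝ) (x ζ : E3) (s : ℝ) :
    ‖mildIntegrand γ β f x ζ s‖ₑ = ENNReal.ofReal (exp (-collisionFreq γ β ζ * s)) *
      ‖integralOp γ β (f (x - s • ζ)) ζ‖ₑ := by
  unfold mildIntegrand
  rw [enorm_mul, Real.enorm_of_nonneg (exp_pos _).le]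

/-- Along almost every trajectory, the mild integrand only depends on the representative of `f`. -/
theorem ae_trajectory_eq {Ω : Set E3} (hΩ : IsOpen Ω) {f g : E3 → E3 → ℝ}
    (hfg : ∀ᵐ y ∂volume.restrict Ω, f y =ᵐ[volume] g y) {x : E3} (hx : x ∈ Ω) :
    ∀ᵐ ζ : E3, ∀ᵐ s ∂volume.restrict (Ioc 0 (exitTime Ω x ζ)),
      0 < s ∧ x - s • ζ ∈ Ω ∧ f (x - s • ζ) =ᵐ[volume] g (x - s • ζ) := by
  filter_upwards [ae_trajectory_of_ae ((ae_restrict_iff' hΩ.measurableSet).1 hfg) x] with ζ hζ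
  have h1 : ∀ᵐ s ∂volume.restrict (Ioc 0 (exitTime Ω x ζ)),
      x - s • ζ ∈ Ω → f (x - s • ζ) =ᵐ[volume] g (x - s • ζ) :=
    ae_mono (Measure.restrict_mono (fun s hs => hs.1) le_rfl) hζ
  -- The exit point itself need not lie in Ω.
  have h2 : ∀ᵐ s ∂volume.restrict (Ioc 0 (exitTime Ω x ζ)), s ≠ exitTime Ω x ζ :=
    ae_restrict_of_ae (Measure.ae_ne volume _)
  filter_upwards [h1, h2, ae_restrict_mem measurableSet_Ioc] with s hs1 hs2 hs
  have hmem := sub_smul_mem_of_lt_exitTime hΩ hx hs.1 (lt_of_le_of_ne hs.2 hs2)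
  exact ⟨hs.1, hmem, hs1 hmem⟩

theorem aemeasurable_integralOp_trajectory (γ : ℝ) {β : ℝ → ℝ} (hβ : Measurable β)
    {f g : E3 → E3 → ℝ} (hg : Measurable fun q : E3 × E3 => g q.1 q.2) {x ζ : E3} {S : Set ℝ}
    (h : ∀ᵐ s ∂volume.restrict S, f (x - s • ζ) =ᵐ[volume] g (x - s • ζ)) :
    AEMeasurable (fun s => integralOp γ β (f (x - s • ζ)) ζ) (volume.restrict S) := by
  refine ⟨fun s => integralOp γ β (g (x - s • ζ)) ζ, ?_, ?_⟩
  · have h1 : Measurable fun s : ℝ => (x - s • ζ, ζ) := by fun_prop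
    have h2 := (measurable_integralOp γ hβ hg).comp h1
    exact h2
  · filter_upwards [h] with s hs
    exact integralOp_congr γ β hs ζ

/-- The trajectory integral of the mild integrand at a fixed velocity. -/
theorem exists_sq_lintegral_mildIntegrand_le {γ : ℝ} {β : ℝ → ℝ} (hB : IsCutoffPotential γ β)
    {α : ℝ} (h0 : 0 < α) (h1 : α < 1) : ∃ C : ℝ≥0∞, C ≠ ∞ ∧ ∀ (Ω : Set E3), IsOpen Ω →
      ∀ f g : E3 → E3 → ℝ, (Measurable fun q : E3 × E3 => g q.1 q.2) →
      (∀ᵐ y ∂volume.restrict Ω, f y =ᵐ[volume] g y) → ∀ x ∈ Ω, ∀ᵐ ζ : E3,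
        (∫⁻ s in Ioc 0 (exitTime Ω x ζ), ‖mildIntegrand γ β f x ζ s‖ₑ) ^ 2 *
            ENNReal.ofReal (collisionFreq γ β ζ) ≤
          C * (ENNReal.ofReal ((1 + ‖ζ‖) ^ (γ * α - 2)) * ∫⁻ s in Ioi (0 : ℝ),
            ENNReal.ofReal (s ^ α) * Ω.indicator (fun y => sqNorm γ β (g y)) (x - s • ζ)) := by
  obtain ⟨K, hK, hKle⟩ := exists_enorm_integralOp_sq_le hB
  obtain ⟨c, C, hc, hC, hν⟩ := exists_collisionFreq_bounds hB
  set G := ∫⁻ t in Ioi (0 : ℝ), ENNReal.ofReal (exp (-t) * t ^ (-α)) with hG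
  have hGt : G ≠ ∞ := lintegral_exp_neg_mul_rpow_ne_top h1
  refine ⟨ENNReal.ofReal (C ^ α) * G * K, by finiteness, fun Ω hΩ f g hg hfg x hx => ?_⟩
  filter_upwards [ae_trajectory_eq hΩ hfg hx] with ζ hζ
  have hν0 : 0 < collisionFreq γ β ζ := lt_of_lt_of_le (by positivity) (hν ζ).1
  have hm := aemeasurable_integralOp_trajectory γ hB.measurable_beta hg
    (hζ.mono fun s hs => hs.2.2)
  -- The time integral contributes ν^(α-1) and the norm ν. The product ν^α grows at most like
  -- (1+|ζ|)^(γα), against the decay (1+|ζ|)⁻² of K.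
  have hpow : ENNReal.ofReal (collisionFreq γ β ζ ^ (α - 1)) * ENNReal.ofReal (collisionFreq γ β ζ)
      * ENNReal.ofReal ((1 + ‖ζ‖) ^ (-2 : ℝ)) ≤
      ENNReal.ofReal (C ^ α) * ENNReal.ofReal ((1 + ‖ζ‖) ^ (γ * α - 2)) := by
    rw [← ENNReal.ofReal_mul (by positivity), ← ENNReal.ofReal_mul (by positivity),
      ← ENNReal.ofReal_mul (by positivity), ← rpow_add_one hν0.ne', sub_add_cancel]
    refine ENNReal.ofReal_le_ofReal ?_
    calc _ ≤ (C * (1 + ‖ζ‖) ^ γ) ^ α * (1 + ‖ζ‖) ^ (-2 : ℝ) := by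
          gcongr; exact (hν ζ).2
      _ = _ := by
          rw [mul_rpow hC.le (by positivity), ← rpow_mul (by positivity), mul_assoc,
            ← rpow_add (by positivity), ← sub_eq_add_neg]
  calc _ ≤ (ENNReal.ofReal (collisionFreq γ β ζ ^ (α - 1)) * G *
        ∫⁻ s in Ioc 0 (exitTime Ω x ζ), ENNReal.ofReal (s ^ α) *
          ‖integralOp γ β (f (x - s • ζ)) ζ‖ₑ ^ 2) * ENNReal.ofReal (collisionFreq γ β ζ) := by
        refine mul_le_mul_left ?_ _
        simp_rw [enorm_mildIntegrand]
        exact sq_lintegral_exp_mul_le hν0 _ hm.enorm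
    _ ≤ (ENNReal.ofReal (collisionFreq γ β ζ ^ (α - 1)) * G *
        ∫⁻ s in Ioi (0 : ℝ), K * ENNReal.ofReal ((1 + ‖ζ‖) ^ (-2 : ℝ)) * (ENNReal.ofReal (s ^ α) *
          Ω.indicator (fun y => sqNorm γ β (g y)) (x - s • ζ))) *
          ENNReal.ofReal (collisionFreq γ β ζ) := by
        refine mul_le_mul_left (mul_le_mul_right ?_ _) _
        -- Once the indicator of Ω is inserted, the time interval may be extended to (0, ∞), and the
        -- exit time disappears from the bound.
        refine le_trans (lintegral_mono_ae ?_) (lintegral_mono_set fun s hs => hs.1)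
        filter_upwards [hζ] with s hs
        have hgm : Measurable (g (x - s • ζ)) := hg.comp (measurable_const.prodMk measurable_id)
        rw [indicator_of_mem hs.2.1, integralOp_congr γ β hs.2.2,
          mul_left_comm (K * _)]
        gcongr
        exact hKle _ hgm.aemeasurable ζ
    _ = (ENNReal.ofReal (collisionFreq γ β ζ ^ (α - 1)) * ENNReal.ofReal (collisionFreq γ β ζ)
          * ENNReal.ofReal ((1 + ‖ζ‖) ^ (-2 : ℝ))) * (G * K * ∫⁻ s in Ioi (0 : ℝ),
          (ENNReal.ofReal (s ^ α) * Ω.indicator (fun y => sqNorm γ β (g y)) (x - s • ζ))) := by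
        rw [lintegral_const_mul' _ _ (by finiteness)]
        ring
    _ ≤ (ENNReal.ofReal (C ^ α) * ENNReal.ofReal ((1 + ‖ζ‖) ^ (γ * α - 2))) *
          (G * K * ∫⁻ s in Ioi (0 : ℝ),
          (ENNReal.ofReal (s ^ α) * Ω.indicator (fun y => sqNorm γ β (g y)) (x - s • ζ))) :=
        mul_le_mul_left hpow _
    _ = _ := by ring

/-- The cutoff is automatic: x and x - y both lie in Ω, so ‖y‖ is below the diameter. -/
theorem lintegral_rpow_mul_le_rieszConv (γ : ℝ) (β : ℝ → ℝ) (α : ℝ) {Ω : Set E3}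
    (hΩ : IsOpen Ω) (hb : Bornology.IsBounded Ω) {f g : E3 → E3 → ℝ}
    (hfg : ∀ᵐ y ∂volume.restrict Ω, f y =ᵐ[volume] g y) {x : E3} (hx : x ∈ Ω) :
    ∫⁻ y, ENNReal.ofReal (‖y‖ ^ (α - 2)) * Ω.indicator (fun y => sqNorm γ β (g y)) (x - y) ≤
      rieszConv γ β α Ω f x := by
  unfold rieszConv lconvolution
  have h1 := (Measure.measurePreserving_sub_left volume x).quasiMeasurePreserving.ae
    ((ae_restrict_iff' hΩ.measurableSet).1 hfg)
  refine lintegral_mono_ae ?_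
  filter_upwards [h1, Measure.ae_ne volume (0 : E3)] with y hy hne
  by_cases hmem : x - y ∈ Ω
  swap
  · rw [indicator_of_notMem hmem, mul_zero]; exact zero_le
  rw [indicator_of_mem hmem, normLStar_sq, neg_add_eq_sub, zeroExt, indicator_of_mem hmem,
    sqNorm_congr γ β (hy hmem)]
  have hn : 0 < ‖y‖ := norm_pos_iff.2 hne
  have hd : ‖y‖ < Metric.diam Ω := by
    have := dist_lt_diam_of_isOpen hΩ hb hx hmem (by
      intro h; exact hne (sub_eq_self.1 h.symm))
    rwa [dist_eq_norm, sub_sub_cancel] at this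
  rw [rieszKernel, indicator_of_mem (mem_Ioo.2 ⟨hn, hd⟩), show α - 2 = -(2 - α) by ring,
    rpow_neg hn.le, one_div]

/-- The measurable majorant `A` serves both the norm bound and the almost everywhere finiteness,
without measurability in ζ of the exit time or of f̃. -/
theorem exists_lintegral_mildIntegrand_le {γ : ℝ} {β : ℝ → ℝ} (hB : IsCutoffPotential γ β)
    {α : ℝ} (h0 : 0 < α) (h1 : α < 1) : ∃ C : ℝ≥0∞, C ≠ ∞ ∧ ∀ (Ω : Set E3), IsOpen Ω →
      Bornology.IsBounded Ω → ∀ f : E3 → E3 → ℝ, MemLStar γ β Ω f → ∀ x ∈ Ω,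
      ∃ A : E3 → ℝ≥0∞, Measurable A ∧
        (∀ᵐ ζ : E3, (∫⁻ s in Ioc 0 (exitTime Ω x ζ), ‖mildIntegrand γ β f x ζ s‖ₑ) ^ 2 *
          ENNReal.ofReal (collisionFreq γ β ζ) ≤ A ζ) ∧
        ∫⁻ ζ, A ζ ≤ C * rieszConv γ β α Ω f x := by
  obtain ⟨C, hC, hle⟩ := exists_sq_lintegral_mildIntegrand_le hB h0 h1
  -- Here γ < 1 makes the scaling integral converge at 0.
  have hδ : γ * α < α := by nlinarith [hB.gamma_lt_one]
  set D := ∫⁻ t in Ioi (0 : ℝ), ENNReal.ofReal (t ^ (α - 3) * (1 + t⁻¹) ^ (γ * α - 2)) with hD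
  have hDt : D ≠ ∞ := lintegral_Ioi_scaling_lt_top h1 hδ
  refine ⟨C * D, by finiteness, fun Ω hΩ hb f hf x hx => ?_⟩
  obtain ⟨g, hg, hfg⟩ := hf.exists_measurable_rep
  set N : E3 → ℝ≥0∞ := Ω.indicator fun y => sqNorm γ β (g y) with hN
  have hNm : Measurable N := (measurable_sqNorm γ β hg).indicator hΩ.measurableSet
  have hm : Measurable fun ζ : E3 => ENNReal.ofReal ((1 + ‖ζ‖) ^ (γ * α - 2)) *
      ∫⁻ s in Ioi (0 : ℝ), ENNReal.ofReal (s ^ α) * N (x - s • ζ) := by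
    refine Measurable.mul (by fun_prop) ?_
    exact Measurable.lintegral_prod_right' (f := fun q : E3 × ℝ =>
      ENNReal.ofReal (q.2 ^ α) * N (x - q.2 • q.1)) (by fun_prop)
  refine ⟨_, hm.const_mul C, hle Ω hΩ f g hg hfg x hx, ?_⟩
  rw [lintegral_const_mul _ hm, lintegral_trajectory _ _ hNm, ← mul_assoc]
  exact mul_le_mul_right (lintegral_rpow_mul_le_rieszConv γ β α hΩ hb hfg hx) _

theorem intervalIntegrable_mildIntegrand {γ : ℝ} {β : ℝ → ℝ} (hB : IsCutoffPotential γ β)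
    {Ω : Set E3} (hΩ : IsOpen Ω) {f : E3 → E3 → ℝ} (hf : MemLStar γ β Ω f) {x : E3} (hx : x ∈ Ω)
    {A : E3 → ℝ≥0∞} (hA : Measurable A)
    (hle : ∀ᵐ ζ : E3, (∫⁻ s in Ioc 0 (exitTime Ω x ζ), ‖mildIntegrand γ β f x ζ s‖ₑ) ^ 2 *
      ENNReal.ofReal (collisionFreq γ β ζ) ≤ A ζ) (hfin : ∫⁻ ζ, A ζ ≠ ∞) :
    ∀ᵐ ζ : E3, IntervalIntegrable (mildIntegrand γ β f x ζ) volume 0 (exitTime Ω x ζ) := by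
  obtain ⟨g, hg, hfg⟩ := hf.exists_measurable_rep
  obtain ⟨c, _, hc, _, hν⟩ := exists_collisionFreq_bounds hB
  filter_upwards [hle, ae_lt_top hA hfin, ae_trajectory_eq hΩ hfg hx] with ζ h1 h2 hζ
  have hm := aemeasurable_integralOp_trajectory γ hB.measurable_beta hg
    (hζ.mono fun s hs => hs.2.2)
  rw [intervalIntegrable_iff_integrableOn_Ioc_of_le (exitTime_nonneg Ω x ζ)]
  refine ⟨AEMeasurable.aestronglyMeasurable (AEMeasurable.mul (by fun_prop) hm), ?_⟩
  have hν0 : 0 < collisionFreq γ β ζ := lt_of_lt_of_le (by positivity) (hν ζ).1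
  rw [hasFiniteIntegral_iff_enorm]
  by_contra hc
  rw [not_lt, top_le_iff] at hc
  rw [hc, ENNReal.top_pow two_ne_zero, ENNReal.top_mul (by simpa using hν0), top_le_iff] at h1
  exact h2.ne h1

/-- No integrability is needed: a divergent time integral has the value 0 by convention, so the
triangle inequality always holds. -/
theorem normLStar_collisionPart_sq_le (γ : ℝ) (β : ℝ → ℝ) (Ω : Set E3) (f : E3 → E3 → ℝ) (x : E3)
    {A : E3 → ℝ≥0∞}
    (hle : ∀ᵐ ζ : E3, (∫⁻ s in Ioc 0 (exitTime Ω x ζ), ‖mildIntegrand γ β f x ζ s‖ₑ) ^ 2 *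
      ENNReal.ofReal (collisionFreq γ β ζ) ≤ A ζ) :
    normLStar γ β (collisionPart γ β Ω f x) ^ 2 ≤ ∫⁻ ζ, A ζ := by
  rw [normLStar_sq]
  refine lintegral_mono_ae (hle.mono fun ζ hζ => le_trans ?_ hζ)
  rw [ENNReal.ofReal_mul (by positivity), ENNReal.ofReal_pow (abs_nonneg _),
    ← Real.enorm_eq_ofReal_abs]
  gcongr
  unfold collisionPart
  rw [intervalIntegral.integral_of_le (exitTime_nonneg Ω x ζ)]
  exact enorm_integral_le_lintegral_enorm _

end LinBoltz

theorem mainTheorem5 (γ : ℝ) (β : ℝ → ℝ) (hB : LinBoltz.IsCutoffPotential γ β)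
    (α : ℝ) (hα0 : 0 < α) (hα1 : α < 1) :
    ∃ C : ℝ, 0 < C ∧
      ∀ (Ω : Set LinBoltz.E3), IsOpen Ω → Convex ℝ Ω → Bornology.IsBounded Ω →
      ∀ f : LinBoltz.E3 → LinBoltz.E3 → ℝ, LinBoltz.MemLStar γ β Ω f →
        -- `K(f)(y, ·)` is given by an absolutely convergent integral for almost every `y`
        (∀ᵐ y ∂(volume.restrict Ω), ∀ ζ : LinBoltz.E3,
          Integrable (LinBoltz.nonlocalIntegrand γ β (f y) ζ) LinBoltz.collisionMeasure) ∧
        ∀ x ∈ Ω,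
          -- `f̃(x, ·)` is given by an absolutely convergent integral where the bound is finite
          (LinBoltz.rieszConv γ β α Ω f x < ∞ → ∀ᵐ ζ : LinBoltz.E3,
            IntervalIntegrable (LinBoltz.mildIntegrand γ β f x ζ) volume
              0 (LinBoltz.exitTime Ω x ζ)) ∧
          LinBoltz.normLStar γ β (LinBoltz.collisionPart γ β Ω f x) ^ 2
            ≤ ENNReal.ofReal C * LinBoltz.rieszConv γ β α Ω f x := by
  obtain ⟨C, hC, hle⟩ := LinBoltz.exists_lintegral_mildIntegrand_le hB hα0 hα1
  -- Adding 1 makes the constant positive even if `C` is zero.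
  refine ⟨C.toReal + 1, by positivity, fun Ω hΩ _ hb f hf =>
    ⟨hf.ae_integrable hB, fun x hx => ?_⟩⟩
  obtain ⟨A, hAm, hA, hAle⟩ := hle Ω hΩ hb f hf x hx
  refine ⟨fun hfin => LinBoltz.intervalIntegrable_mildIntegrand hB hΩ hf hx hAm hA
    (hAle.trans_lt (ENNReal.mul_lt_top hC.lt_top hfin)).ne,
    (LinBoltz.normLStar_collisionPart_sq_le γ β Ω f x hA).trans (hAle.trans ?_)⟩
  gcongr
  exact ENNReal.le_ofReal_iff_toReal_le hC (by positivity) |>.2 (by linarith)
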